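/- Let $\mathcal X,\mathcal Y$ be finite alphabets, let $P_{Y|X}$ be a channel (a stochastic matrix) from $\mathcal X$ to $\mathcal Y$, and let $P_{Y^n|X^n}(y^n|x^n)=\prod_{i=1}^n P_{Y|X}(y_i|x_i)$ be its memoryless extension. Let $m\ge 1$ be a fixed integer and let $P_{\bar X}$ be a fixed $m$-type on $\mathcal X$, i.e. a probability distribution all of whose masses are integer multiples of $1/m$. Assume that the channel is non-degenerate for $P_{\bar X}$, i.e. that input and output are not independent under $P_{\bar XY}:=P_{\bar X}P_{Y|X}$ (equivalently, $I(P_{\bar X},P_{Y|X})>0$), and let $R>I(P_{\bar X},P_{Y|X})$ be a real number. All logarithms and exponentials are natural. For each positive multiple $n$ of $m$, let $\mathcal T^n_{P_{\bar X}}$ be the set of all $x^n\in\mathcal X^n$ with empirical distribution $P_{\bar X}$, let $R_{\breve Y^n}$ be the distribution of the output of $P_{Y^n|X^n}$ when the input is uniformly distributed on $\mathcal T^n_{P_{\bar X}}$, let $M=\lceil\exp(nR)\rceil$, let $\breve X_1^n,\dots,\breve X_M^n$ be independent and uniformly distributed on $\mathcal T^n_{P_{\bar X}}$, and let $$P_{\breve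 Y^n|\mathscr D^n_M}(y^n)=\frac1M\sum_{j=1}^M P_{Y^n|X^n}(y^n|\breve X_j^n).$$ Then, with $\|P-Q\|_1=\sum_y|P(y)-Q(y)|$, the expectation below is positive for all large $n\in m\mathbb N$, and, as $n\to\infty$ along the multiples of $m$, $$\lim_{n\to\infty}-\frac1n\log\mathbb E\Big[\big\|P_{\breve Y^n|\mathscr D^n_M}-R_{\breve Y^n}\big\|_1\Big]=\min_{Q_{Y|X}}\Big\{D(P_{\bar X}Q_{Y|X}\|P_{\bar XY})+\tfrac12\big[R-D(P_{\bar X}Q_{Y|X}\|P_{\bar X}Q_Y)\big]_+\Big\}=\max_{\lambda\in[1,2]}\Big\{\frac{\lambda-1}{\lambda}\big(R-I^{\mathsf c}_\lambda(P_{\bar X},P_{Y|X})\big)\Big\}.$$ The minimum is over all channels $Q_{Y|X}$ from $\mathcal X$ to $\mathcal Y$, $Q_Y$ is the output distribution of $Q_{Y|X}$ for the input distribution $P_{\bar X}$, $P_{\bar X}Q_Y$ is the product distribution, $[f]_+=\max\{0,f\}$, and $D$ is relative entropy ($+\infty$ in the absence of absolute continuity). Further, $I^{\mathsf c}_\lambda(P_{\bar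 X},P_{Y|X})=\min_{S_Y}\sum_{x}P_{\bar X}(x)\,D_\lambda\big(P_{Y|X}(\cdot|x)\,\|\,S_Y\big)$ is Csiszár's $\alpha$-mutual information of order $\lambda$, where the minimum is over all probability distributions $S_Y$ on $\mathcal Y$ and $D_\lambda$ is the Rényi divergence of order $\lambda$ ($D_1=D$). -/

import Mathlib

open Filter Topology

namespace SoftCovering

noncomputable section

/-! Finite alphabets; a distribution on `α` is an element of `stdSimplex ℝ α`, given by its mass
function.  Logarithms and exponentials are natural. -/

/-- `W : α → β → ℝ` is a random transformation from `α` to `β`: `W a b` is the probability of the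
output `b` given the input `a`. -/
def IsChannel {α β : Type*} [Fintype β] (W : α → β → ℝ) : Prop :=
  ∀ a, W a ∈ stdSimplex ℝ β

/-- The joint distribution `P W` on `α × β` of an input with law `P` and its output through `W`. -/
def jointDist {α β : Type*} (P : α → ℝ) (W : α → β → ℝ) : α × β → ℝ :=
  fun p => P p.1 * W p.1 p.2

/-- The product distribution `P ⊗ S` on `α × β`. -/
def prodDist {α β : Type*} (P : α → ℝ) (S : β → ℝ) : α × β → ℝ :=
  fun p => P p.1 * S p.2

/-- The output distribution of the channel `W` when the input has law `P`. -/
def outputDist {α β : Type*} [Fintype α] (P : α → ℝ) (W : α → β → ℝ) : β → ℝ :=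
  fun b => ∑ a, P a * W a b

/-- Absolute continuity `P ≪ Q` of mass functions. -/
def AbsCont {α : Type*} (P Q : α → ℝ) : Prop := ∀ a, Q a = 0 → P a = 0

open scoped Classical in
/-- Relative entropy `D(P‖Q) = ∑ P log (P / Q)`, equal to `+∞` unless `P ≪ Q`. -/
def relEntropy {α : Type*} [Fintype α] (P Q : α → ℝ) : EReal :=
  if AbsCont P Q then ((∑ a, P a * Real.log (P a / Q a) : ℝ) : EReal) else ⊤

/-- Mutual information `I(P, W) = D(P W ‖ P ⊗ P_Y)`. -/
def mutualInfo {α β : Type*} [Fintype α] [Fintype β] (P : α → ℝ) (W : α → β → ℝ) : EReal :=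
  relEntropy (jointDist P W) (prodDist P (outputDist P W))

open scoped Classical in
/-- Rényi divergence `D_l(P‖Q)` of order `l ≥ 1` (the relative entropy for `l = 1`). -/
def renyiDiv {α : Type*} [Fintype α] (l : ℝ) (P Q : α → ℝ) : EReal :=
  if l = 1 then relEntropy P Q
  else if AbsCont P Q then
    ((1 / (l - 1) * Real.log (∑ a, P a ^ l * Q a ^ (1 - l)) : ℝ) : EReal)
  else ⊤

/-- Csiszár's `α`-mutual information of order `l ≥ 1`: the minimum over all distributions `S` on
the output alphabet of the average of `D_l(W(·|X) ‖ S)` for `X ∼ P`. -/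
def csiszarInfo {α β : Type*} [Fintype α] [Fintype β] (l : ℝ) (P : α → ℝ) (W : α → β → ℝ) :
    EReal :=
  ⨅ S ∈ stdSimplex ℝ β, ∑ a, (P a : EReal) * renyiDiv l (W a) S

/-- Total variation (`ℓ₁`) distance, without the factor `1/2`. -/
def l1Dist {α : Type*} [Fintype α] (P Q : α → ℝ) : ℝ := ∑ a, |P a - Q a|

/-- The `n`-shot stationary memoryless channel. -/
def channelPow {α β : Type*} (W : α → β → ℝ) (n : ℕ) : (Fin n → α) → (Fin n → β) → ℝ :=
  fun x y => ∏ i, W (x i) (y i)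

/-- `P` is an `n`-type: a distribution whose masses are integer multiples of `1/n`. -/
def IsType {α : Type*} [Fintype α] (n : ℕ) (P : α → ℝ) : Prop :=
  P ∈ stdSimplex ℝ α ∧ ∀ a, ∃ k : ℕ, k ≤ n ∧ P a = (k : ℝ) / (n : ℝ)

open scoped Classical in
/-- The empirical distribution of a sequence `x` of length `n`. -/
def empDist {α : Type*} {n : ℕ} (x : Fin n → α) : α → ℝ :=
  fun a => ((Finset.univ.filter fun i => x i = a).card : ℝ) / (n : ℝ)

open scoped Classical in
/-- The type class of `P`: all sequences of length `n` with empirical distribution `P`. -/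
def typeClass {α : Type*} [Fintype α] (n : ℕ) (P : α → ℝ) : Finset (Fin n → α) :=
  Finset.univ.filter fun x => empDist x = P

open scoped Classical in
/-- The constant-composition distribution: uniform on the type class of `P`. -/
def ccDist {α : Type*} [Fintype α] (n : ℕ) (P : α → ℝ) : (Fin n → α) → ℝ :=
  fun x => if x ∈ typeClass n P then 1 / ((typeClass n P).card : ℝ) else 0

/-- The output distribution induced by the codebook `c` of `M` codewords: a uniformly chosen
codeword is sent through the channel `V`. -/
def inducedDist {ξ η : Type*} {M : ℕ} (V : ξ → η → ℝ) (c : Fin M → ξ) : η → ℝ :=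
  fun y => 1 / (M : ℝ) * ∑ j, V (c j) y

/-- Expectation of `f c` when the `M` codewords of `c` are independent with common law `p`. -/
def codebookExp {ξ : Type*} [Fintype ξ] (p : ξ → ℝ) (M : ℕ) (f : (Fin M → ξ) → ℝ) : ℝ :=
  ∑ c : Fin M → ξ, (∏ j, p (c j)) * f c

/-- The expected total variation distance between the output distribution induced by a random
constant-composition codebook of size `M` and block-length `n` based on `P`, and the output
distribution for an input that is uniform on the type class of `P`. -/
def expectedTV {α β : Type*} [Fintype α] [Fintype β] (P : α → ℝ) (W : α → β → ℝ) (n M : ℕ) : ℝ :=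
  codebookExp (ccDist n P) M fun c =>
    l1Dist (inducedDist (channelPow W n) c) (outputDist (ccDist n P) (channelPow W n))

/-- The channel is degenerate for the input law `P`: output and input are independent, i.e. the
conditional output law equals the output law for every input of positive probability. -/
def IsDegenerate {α β : Type*} [Fintype α] (P : α → ℝ) (W : α → β → ℝ) : Prop :=
  ∀ a, P a ≠ 0 → W a = outputDist P W

/-- The function of `Q = Q_{Y|X}` that is minimized in the exponent,
`D(P Q ‖ P W) + ½ [R - D(P Q ‖ P ⊗ Q_Y)]₊`. -/
def primalObjective {α β : Type*} [Fintype α] [Fintype β] (R : ℝ) (P : α → ℝ) (W : α → β → ℝ)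
    (Q : α → β → ℝ) : EReal :=
  relEntropy (jointDist P Q) (jointDist P W) +
    ((1 / 2 : ℝ) : EReal) *
      max 0 ((R : EReal) - relEntropy (jointDist P Q) (prodDist P (outputDist P Q)))

/-- The function of `l` that is maximized in the exponent, `((l - 1) / l) (R - I^c_l(P, W))`. -/
def dualObjective {α β : Type*} [Fintype α] [Fintype β] (R : ℝ) (P : α → ℝ) (W : α → β → ℝ)
    (l : ℝ) : EReal :=
  (((l - 1) / l : ℝ) : EReal) * ((R : EReal) - csiszarInfo l P W)

end

end SoftCovering

/-! The exponent is squeezed between two non-asymptotic bounds on the expected distance, both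
obtained for each output sequence separately, and strong duality makes the bounds meet.

Exponent from below. For fixed `y` the induced mass is an empirical mean of M i.i.d. nonnegative
variables. Truncating these variables bounds the mean deviation by their moment of order l in [1, 2]
(`codebookExp_abs_mean_sub_le_rpow`). Summing over `y` with Jensen's inequality, relative to an
auxiliary product law S, factorizes the moment over letters, exactly because the input type is fixed
(`expectedTV_le`). This gives a dual value for every l and every S dominating W.

Exponent from above. The deviation is tested against a product over codewords of unimodular complex
numbers, equal to ζ on a set A and to 1 off it. Independence evaluates the test in closed form, and
a constant fraction survives when M·P(A)·|ζ - 1|² ≤ 1 (`le_codebookExp_abs_mean_sub`). With A the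
inputs jointly typical with `y` under a test channel Q, this yields the primal value at Q, provided
D(Q‖W|P) < I(P,Q) (`exp_le_expectedTV`). The optimal Q satisfies this proviso because it does at
least as well as W, whose mutual information lies strictly between 0 and R (`condDiv_lt_mutInf`).

Duality. The primal objective is the maximum of the Lagrangians D + r(R - I) at r = 0 and r = 1/2,
both convex in Q, so a separation argument supplies a multiplier r in [0, 1/2]
(`exists_primal_minimizer`). For r > 0 a Lagrangian minimizer is the tilted channel proportional to
W^l S^(1-l), with l = 1/(1-r) and S its own output law, up to inputs of probability zero; its value
is a dual value (`lagrangian_le_of_isMin`). Weak duality needs no separate algebra: the two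
operational bounds apply to the same sequence, so no dual value exceeds the primal minimum. -/

namespace SoftCovering

/-! ### Sums over product weights: independence, variance, Chebyshev. -/

section ProductExpectation

variable {ι ξ : Type*} [Fintype ι] [DecidableEq ι]

theorem prod_mul_apply {R : Type*} [CommSemiring R] (w : ι → ξ → R)
    (j : ι) (g : ξ → R) (c : ι → ξ) :
    (∏ i, w i (c i)) * g (c j) = ∏ i, Function.update w j (fun a => w j a * g a) i (c i) := by
  rw [← Finset.mul_prod_erase _ (fun i => w i (c i)) (Finset.mem_univ j),
    ← Finset.mul_prod_erase _ (fun i => Function.update w j (fun a => w j a * g a) i (c i))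
      (Finset.mem_univ j)]
  have : ∏ i ∈ Finset.univ.erase j, Function.update w j (fun a => w j a * g a) i (c i)
      = ∏ i ∈ Finset.univ.erase j, w i (c i) := by
    refine Finset.prod_congr rfl fun i hi => ?_
    rw [Function.update_of_ne (Finset.ne_of_mem_erase hi)]
  rw [this, Function.update_self]
  ring

variable [Fintype ξ]

theorem sum_pi_prod {R : Type*} [CommSemiring R] (f : ι → ξ → R) :
    ∑ c : ι → ξ, ∏ i, f i (c i) = ∏ i, ∑ a, f i a := by
  rw [Finset.prod_univ_sum, Fintype.piFinset_univ]

theorem sum_pi_prod_mul_apply {R : Type*} [CommSemiring R] (w : ι → ξ → R)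
    (j : ι) (g : ξ → R) :
    ∑ c : ι → ξ, (∏ i, w i (c i)) * g (c j)
      = (∑ a, w j a * g a) * ∏ i ∈ Finset.univ.erase j, ∑ a, w i a := by
  simp_rw [prod_mul_apply, sum_pi_prod]
  rw [← Finset.mul_prod_erase _ _ (Finset.mem_univ j), Function.update_self]
  congr 1
  refine Finset.prod_congr rfl fun i hi => ?_
  rw [Function.update_of_ne (Finset.ne_of_mem_erase hi)]

theorem sum_pi_mul_apply (p : ι → ξ → ℝ) (hp : ∀ i, ∑ a, p i a = 1) (j : ι) (g : ξ → ℝ) :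
    ∑ c : ι → ξ, (∏ i, p i (c i)) * g (c j) = ∑ a, p j a * g a := by
  rw [sum_pi_prod_mul_apply, Finset.prod_eq_one fun i _ => hp i, mul_one]

theorem sum_pi_mul_sum (p : ι → ξ → ℝ) (hp : ∀ i, ∑ a, p i a = 1) (g : ι → ξ → ℝ) :
    ∑ c : ι → ξ, (∏ i, p i (c i)) * ∑ j, g j (c j) = ∑ j, ∑ a, p j a * g j a := by
  simp_rw [Finset.mul_sum]
  rw [Finset.sum_comm]
  exact Finset.sum_congr rfl fun j _ => sum_pi_mul_apply p hp j (g j)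

/-- Variance of a sum of independent centred variables. -/
theorem sum_pi_mul_sum_sq (p : ι → ξ → ℝ) (hp : ∀ i, ∑ a, p i a = 1) (g : ι → ξ → ℝ)
    (hg : ∀ i, ∑ a, p i a * g i a = 0) :
    ∑ c : ι → ξ, (∏ i, p i (c i)) * (∑ j, g j (c j)) ^ 2 = ∑ j, ∑ a, p j a * g j a ^ 2 := by
  simp_rw [sq (∑ j, _), Finset.sum_mul_sum, Finset.mul_sum]
  rw [Finset.sum_comm]
  refine Finset.sum_congr rfl fun j _ => ?_
  rw [Finset.sum_comm, Finset.sum_eq_single j]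
  · rw [← sum_pi_mul_apply p hp j]
    exact Finset.sum_congr rfl fun c _ => by ring
  · intro k _ hk
    -- Cross terms vanish: `g k` is absorbed into the weight at `k`, and the sum over coordinate `j`
    -- factors out and is zero by centring.
    have h := sum_pi_prod_mul_apply (Function.update p k (fun a => p k a * g k a)) j (g j)
    rw [Function.update_of_ne hk.symm, hg, zero_mul] at h
    rw [← h]
    refine Finset.sum_congr rfl fun c _ => ?_
    rw [← prod_mul_apply]
    ring
  · simp

theorem sum_pi_eq_one (p : ι → ξ → ℝ) (hp : ∀ i, ∑ a, p i a = 1) :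
    ∑ c : ι → ξ, ∏ i, p i (c i) = 1 := by
  rw [sum_pi_prod]
  exact Finset.prod_eq_one fun i _ => hp i

/-- Chebyshev's inequality for a sum of independent variables. -/
theorem chebyshev_pi (p : ι → ξ → ℝ) (hp0 : ∀ i a, 0 ≤ p i a) (hp : ∀ i, ∑ a, p i a = 1)
    (g : ι → ξ → ℝ) {B t : ℝ} (hB : ∀ i, ∑ a, p i a * g i a ^ 2 ≤ B) (ht : 0 < t)
    (s : Finset (ι → ξ))
    (hs : ∀ c ∈ s, ∑ i, g i (c i) ≤ (∑ i, ∑ a, p i a * g i a) - t) :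
    ∑ c ∈ s, ∏ i, p i (c i) ≤ Fintype.card ι * B / t ^ 2 := by
  set μ : ι → ℝ := fun i => ∑ a, p i a * g i a with hμ
  have hc : ∀ i, ∑ a, p i a * (g i a - μ i) = 0 := fun i => by
    simp_rw [mul_sub, Finset.sum_sub_distrib, ← Finset.sum_mul, hp]
    simp [hμ]
  have hv := sum_pi_mul_sum_sq p hp (fun i a => g i a - μ i) hc
  have hle : ∑ j, ∑ a, p j a * (g j a - μ j) ^ 2 ≤ Fintype.card ι * B := by
    rw [← nsmul_eq_mul, ← Finset.card_univ]
    refine Finset.sum_le_card_nsmul _ _ _ fun i _ => le_trans ?_ (hB i)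
    have : ∑ a, p i a * (g i a - μ i) ^ 2 = ∑ a, p i a * g i a ^ 2 - μ i ^ 2 := by
      have : ∀ a, p i a * (g i a - μ i) ^ 2
          = p i a * g i a ^ 2 - 2 * μ i * (p i a * g i a) + μ i ^ 2 * p i a := fun a => by ring
      simp_rw [this, Finset.sum_add_distrib, Finset.sum_sub_distrib, ← Finset.mul_sum, hp]
      simp only [hμ]; ring
    rw [this]
    nlinarith [sq_nonneg (μ i)]
  have hw : ∀ c : ι → ξ, 0 ≤ ∏ i, p i (c i) := fun c => Finset.prod_nonneg fun i _ => hp0 _ _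
  rw [le_div_iff₀ (by positivity), Finset.sum_mul]
  calc ∑ c ∈ s, (∏ i, p i (c i)) * t ^ 2
      ≤ ∑ c ∈ s, (∏ i, p i (c i)) * (∑ j, (g j (c j) - μ j)) ^ 2 := by
        refine Finset.sum_le_sum fun c hcs => mul_le_mul_of_nonneg_left ?_ (hw c)
        have := hs c hcs
        rw [Finset.sum_sub_distrib]
        nlinarith
    _ ≤ ∑ c : ι → ξ, (∏ i, p i (c i)) * (∑ j, (g j (c j) - μ j)) ^ 2 :=
        Finset.sum_le_sum_of_subset_of_nonneg (Finset.subset_univ _)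
          fun c _ _ => mul_nonneg (hw c) (sq_nonneg _)
    _ ≤ _ := hv.trans_le hle

end ProductExpectation

/-! ### Mean deviation of an empirical mean: moment upper bound and test-function lower bound. -/

section Codebook

variable {ξ : Type*} [Fintype ξ]

theorem codebookExp_mono {p : ξ → ℝ} (hp : ∀ a, 0 ≤ p a) {M : ℕ} {f g : (Fin M → ξ) → ℝ}
    (h : ∀ c, f c ≤ g c) : codebookExp p M f ≤ codebookExp p M g :=
  Finset.sum_le_sum fun c _ => mul_le_mul_of_nonneg_left (h c) (Finset.prod_nonneg fun _ _ => hp _)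

theorem codebookExp_add (p : ξ → ℝ) (M : ℕ) (f g : (Fin M → ξ) → ℝ) :
    codebookExp p M (fun c => f c + g c) = codebookExp p M f + codebookExp p M g := by
  simp [codebookExp, mul_add, Finset.sum_add_distrib]

theorem codebookExp_const_mul (p : ξ → ℝ) (M : ℕ) (r : ℝ) (f : (Fin M → ξ) → ℝ) :
    codebookExp p M (fun c => r * f c) = r * codebookExp p M f := by
  simp only [codebookExp, Finset.mul_sum]
  exact Finset.sum_congr rfl fun c _ => by ring

theorem codebookExp_const {p : ξ → ℝ} (hp : ∑ a, p a = 1) (M : ℕ) (r : ℝ) :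
    codebookExp p M (fun _ => r) = r := by
  rw [codebookExp, ← Finset.sum_mul, sum_pi_eq_one (fun _ => p) fun _ => hp, one_mul]

theorem codebookExp_mean {p : ξ → ℝ} (hp : ∑ a, p a = 1) {M : ℕ} (hM : 0 < M) (v : ξ → ℝ) :
    codebookExp p M (fun c => 1 / (M : ℝ) * ∑ j, v (c j)) = ∑ a, p a * v a := by
  have hM' : (M : ℝ) ≠ 0 := by positivity
  rw [codebookExp_const_mul, codebookExp, sum_pi_mul_sum (fun _ => p) (fun _ => hp) fun _ => v]
  simp [hM']

/-- Cauchy–Schwarz bound on the mean deviation of an empirical mean. -/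
theorem codebookExp_abs_mean_sub_le_sqrt {p : ξ → ℝ} (hp0 : ∀ a, 0 ≤ p a) (hp : ∑ a, p a = 1)
    {M : ℕ} (hM : 0 < M) (v : ξ → ℝ) :
    codebookExp p M (fun c => |1 / (M : ℝ) * ∑ j, v (c j) - ∑ a, p a * v a|)
      ≤ √((∑ a, p a * v a ^ 2) / M) := by
  have hM' : (0 : ℝ) < M := by positivity
  set μ := ∑ a, p a * v a with hμ
  have hc : ∑ a, p a * (v a - μ) = 0 := by
    simp_rw [mul_sub, Finset.sum_sub_distrib, ← Finset.sum_mul, hp]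
    simp [hμ]
  have hv := sum_pi_mul_sum_sq (fun _ : Fin M => p) (fun _ => hp) (fun _ a => v a - μ) fun _ => hc
  have hle : ∑ a, p a * (v a - μ) ^ 2 ≤ ∑ a, p a * v a ^ 2 := by
    have : ∀ a, p a * (v a - μ) ^ 2 = p a * v a ^ 2 - 2 * μ * (p a * v a) + μ ^ 2 * p a :=
      fun a => by ring
    simp_rw [this, Finset.sum_add_distrib, Finset.sum_sub_distrib, ← Finset.mul_sum, hp, ← hμ]
    nlinarith [sq_nonneg μ]
  have hw : ∀ c : Fin M → ξ, 0 ≤ ∏ i, p (c i) := fun c => Finset.prod_nonneg fun i _ => hp0 _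
  refine Real.le_sqrt_of_sq_le ?_
  -- The weight is split as √w · √w: one factor has total mass one, the other gives the variance.
  have hcs := Finset.sum_mul_sq_le_sq_mul_sq Finset.univ (fun c : Fin M → ξ => √(∏ j, p (c j)))
    (fun c => √(∏ j, p (c j)) * |1 / (M : ℝ) * ∑ j, v (c j) - μ|)
  have e1 : ∀ c : Fin M → ξ, √(∏ j, p (c j)) * (√(∏ j, p (c j)) *
      |1 / (M : ℝ) * ∑ j, v (c j) - μ|) = (∏ j, p (c j)) * |1 / (M : ℝ) * ∑ j, v (c j) - μ| :=
    fun c => by rw [← mul_assoc, Real.mul_self_sqrt (hw c)]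
  have e2 : ∀ c : Fin M → ξ, (√(∏ j, p (c j)) * |1 / (M : ℝ) * ∑ j, v (c j) - μ|) ^ 2
      = (1 / (M : ℝ)) ^ 2 * ((∏ j, p (c j)) * (∑ j, (v (c j) - μ)) ^ 2) := fun c => by
    rw [mul_pow, Real.sq_sqrt (hw c), sq_abs, Finset.sum_sub_distrib]
    simp only [Finset.sum_const, Finset.card_univ, Fintype.card_fin, nsmul_eq_mul]
    field_simp
  simp_rw [e1, e2, Real.sq_sqrt (hw _), ← Finset.mul_sum] at hcs
  rw [sum_pi_eq_one (fun _ : Fin M => p) fun _ => hp, one_mul, hv] at hcs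
  refine hcs.trans ?_
  simp only [Finset.sum_const, Finset.card_univ, Fintype.card_fin, nsmul_eq_mul]
  rw [show (1 / (M : ℝ)) ^ 2 * (M * ∑ a, p a * (v a - μ) ^ 2)
    = (∑ a, p a * (v a - μ) ^ 2) / M by field_simp]
  gcongr

/-- Triangle inequality: the empirical mean and its centre have the same expectation. Averaging
gains nothing here, which suffices for the large values cut off by a truncation. -/
theorem codebookExp_abs_mean_sub_le_two_mul {p : ξ → ℝ} (hp0 : ∀ a, 0 ≤ p a)
    (hp : ∑ a, p a = 1) {M : ℕ} (hM : 0 < M) {v : ξ → ℝ} (hv : ∀ a, 0 ≤ v a) :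
    codebookExp p M (fun c => |1 / (M : ℝ) * ∑ j, v (c j) - ∑ a, p a * v a|)
      ≤ 2 * ∑ a, p a * v a := by
  have h0 : 0 ≤ ∑ a, p a * v a := Finset.sum_nonneg fun a _ => mul_nonneg (hp0 a) (hv a)
  calc _ ≤ codebookExp p M (fun c => 1 / (M : ℝ) * ∑ j, v (c j) + ∑ a, p a * v a) := by
        refine codebookExp_mono hp0 fun c => ?_
        have : 0 ≤ 1 / (M : ℝ) * ∑ j, v (c j) :=
          mul_nonneg (by positivity) (Finset.sum_nonneg fun j _ => hv _)
        rw [abs_le]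
        constructor <;> linarith
    _ = _ := by
        rw [codebookExp_add, codebookExp_mean hp hM, codebookExp_const hp]
        ring

/-- A von Bahr–Esseen type inequality: the mean deviation of an empirical mean of nonnegative
variables is controlled by their moment of order `l ∈ [1, 2]`. -/
theorem codebookExp_abs_mean_sub_le_rpow {p : ξ → ℝ} (hp0 : ∀ a, 0 ≤ p a) (hp : ∑ a, p a = 1)
    {M : ℕ} (hM : 0 < M) {v : ξ → ℝ} (hv : ∀ a, 0 ≤ v a) {l : ℝ} (hl : l ∈ Set.Icc (1 : ℝ) 2) :
    codebookExp p M (fun c => |1 / (M : ℝ) * ∑ j, v (c j) - ∑ a, p a * v a|)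
      ≤ 3 * ((M : ℝ) ^ (1 - l) * ∑ a, p a * v a ^ l) ^ (1 / l) := by
  classical
  obtain ⟨hl1, hl2⟩ := hl
  have hl0 : 0 < l := by linarith
  have hMp : (0 : ℝ) < M := by positivity
  set K := ∑ a, p a * v a ^ l with hK
  have hKt : ∀ a, 0 ≤ p a * v a ^ l := fun a => mul_nonneg (hp0 a) (Real.rpow_nonneg (hv a) _)
  have hK0 : 0 ≤ K := Finset.sum_nonneg fun a _ => hKt a
  rcases hK0.eq_or_lt with hK1 | hK1
  · have hz : ∑ a, p a * v a = 0 := by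
      refine Finset.sum_eq_zero fun a _ => ?_
      have := (Finset.sum_eq_zero_iff_of_nonneg fun a _ => hKt a).1 hK1.symm a (Finset.mem_univ a)
      rcases mul_eq_zero.1 this with h | h
      · rw [h, zero_mul]
      · rw [(Real.rpow_eq_zero (hv a) hl0.ne').1 h, mul_zero]
    refine (codebookExp_abs_mean_sub_le_two_mul hp0 hp hM hv).trans ?_
    rw [hz, mul_zero]
    positivity
  -- This threshold balances the two parts: √(t^(2-l) K / M) and t^(1-l) K both equal `G`. The part
  -- below `t` costs `G` by Cauchy–Schwarz and the part above costs `2 * G`, hence the constant 3.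
  set t : ℝ := ((M : ℝ) * K) ^ (1 / l) with ht
  have htp : 0 < t := by positivity
  set v₁ : ξ → ℝ := fun a => if v a ≤ t then v a else 0 with hv₁
  set v₂ : ξ → ℝ := fun a => if v a ≤ t then 0 else v a with hv₂
  have hadd : ∀ a, v a = v₁ a + v₂ a := fun a => by simp only [hv₁, hv₂]; split_ifs <;> simp
  have hv₂0 : ∀ a, 0 ≤ v₂ a := fun a => by simp only [hv₂]; split_ifs; exacts [le_rfl, hv a]
  have b1 : ∑ a, p a * v₁ a ^ 2 ≤ t ^ (2 - l) * K := by
    rw [hK, Finset.mul_sum]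
    refine Finset.sum_le_sum fun a _ => ?_
    rw [mul_left_comm]
    refine mul_le_mul_of_nonneg_left ?_ (hp0 a)
    simp only [hv₁]
    split_ifs with h
    · rcases (hv a).eq_or_lt with h0 | h0
      · rw [← h0]; simp only [ne_eq, OfNat.ofNat_ne_zero, not_false_eq_true, zero_pow]
        positivity
      · calc v a ^ 2 = v a ^ (2 - l) * v a ^ l := by
              rw [← Real.rpow_add h0]; norm_num
          _ ≤ _ := by gcongr
    · have := hv a
      simp only [ne_eq, OfNat.ofNat_ne_zero, not_false_eq_true, zero_pow]
      positivity
  have b2 : ∑ a, p a * v₂ a ≤ t ^ (1 - l) * K := by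
    rw [hK, Finset.mul_sum]
    refine Finset.sum_le_sum fun a _ => ?_
    rw [mul_left_comm]
    refine mul_le_mul_of_nonneg_left ?_ (hp0 a)
    simp only [hv₂]
    split_ifs with h
    · have := hv a
      positivity
    · have h0 : 0 < v a := htp.trans (not_le.1 h)
      calc v a = v a ^ (1 - l) * v a ^ l := by rw [← Real.rpow_add h0]; norm_num
        _ ≤ _ := by
          refine mul_le_mul_of_nonneg_right ?_ (by positivity)
          exact Real.rpow_le_rpow_of_nonpos htp (not_le.1 h).le (by linarith)
  set G := ((M : ℝ) ^ (1 - l) * K) ^ (1 / l) with hG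
  have hGp : 0 ≤ G := by positivity
  have elog : ∀ r : ℝ, 0 < r → r = Real.exp (Real.log r) := fun r hr => (Real.exp_log hr).symm
  have e1 : t ^ (1 - l) * K = G := by
    rw [hG, ht, elog (M : ℝ) hMp, elog K hK1]
    simp only [← Real.exp_add, ← Real.exp_mul]
    congr 1
    field_simp
    ring
  have e2 : t ^ (2 - l) * K / M = G ^ 2 := by
    have : t ^ (2 - l) = t ^ (1 - l) * t := by
      rw [← Real.rpow_add_one htp.ne']; ring_nf
    rw [this, show t ^ (1 - l) * t * K / M = (t ^ (1 - l) * K) * (t / M) by ring, e1, sq]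
    congr 1
    rw [hG, ht, elog (M : ℝ) hMp, elog K hK1]
    simp only [← Real.exp_add, ← Real.exp_mul, ← Real.exp_sub]
    congr 1
    field_simp
    ring
  calc _ ≤ codebookExp p M (fun c => |1 / (M : ℝ) * ∑ j, v₁ (c j) - ∑ a, p a * v₁ a|
          + |1 / (M : ℝ) * ∑ j, v₂ (c j) - ∑ a, p a * v₂ a|) := by
        refine codebookExp_mono hp0 fun c => ?_
        simp_rw [hadd, mul_add, Finset.sum_add_distrib]
        refine le_trans (le_of_eq ?_) (abs_add_le _ _)
        congr 1
        ring
    _ ≤ G + 2 * G := by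
        rw [codebookExp_add]
        refine add_le_add ((codebookExp_abs_mean_sub_le_sqrt hp0 hp hM v₁).trans ?_)
          ((codebookExp_abs_mean_sub_le_two_mul hp0 hp hM hv₂0).trans ?_)
        · rw [← Real.sqrt_sq hGp, ← e2]
          gcongr
        · linarith
    _ = _ := by ring

/-- For M > 1, 1 - 1/M is the inverse of 1 + 1/(M-1), which is at most exp(1/(M-1)). The power M - 1
counts the codewords left after one is singled out. -/
theorem exp_neg_one_le_one_sub_inv_pow {M : ℕ} (hM : 0 < M) :
    Real.exp (-1) ≤ (1 - 1 / (M : ℝ)) ^ (M - 1) := by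
  obtain ⟨k, rfl⟩ := Nat.exists_eq_succ_of_ne_zero hM.ne'
  rcases Nat.eq_zero_or_pos k with rfl | hk
  · simp
  have hk' : (0 : ℝ) < k := by positivity
  have h1 : Real.exp (-(1 / (k : ℝ))) ≤ 1 - 1 / ((k + 1 : ℕ) : ℝ) := by
    have h := Real.add_one_le_exp (1 / (k : ℝ))
    rw [Real.exp_neg]
    refine (inv_anti₀ (by positivity) h).trans (le_of_eq ?_)
    push_cast
    field_simp
    ring
  calc Real.exp (-1) = Real.exp (-(1 / (k : ℝ))) ^ k := by
        rw [← Real.exp_nat_mul]; congr 1; field_simp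
    _ ≤ _ := by
        simpa using pow_le_pow_left₀ (Real.exp_pos _).le h1 k

/-- Lower bound on the mean deviation of an empirical mean, by testing it against a product of
complex numbers of modulus one. -/
theorem le_codebookExp_abs_mean_sub {p : ξ → ℝ} (hp0 : ∀ a, 0 ≤ p a) (hp : ∑ a, p a = 1)
    {M : ℕ} (hM : 0 < M) (v : ξ → ℝ) (A : Finset ξ) {s : ℝ} (hs0 : 0 ≤ s) (hs1 : s ≤ 1)
    (hs : (M : ℝ) * (∑ a ∈ A, p a) * s ≤ 1) :
    1 / 2 * √s * ∑ a ∈ A, p a * (v a - ∑ b, p b * v b)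
      ≤ codebookExp p M (fun c => |1 / (M : ℝ) * ∑ j, v (c j) - ∑ a, p a * v a|) := by
  classical
  have hMp : (0 : ℝ) < M := by positivity
  set μ := ∑ b, p b * v b with hμ
  set q := ∑ a ∈ A, p a with hq
  have hq0 : 0 ≤ q := Finset.sum_nonneg fun a _ => hp0 a
  have hq1 : q ≤ 1 := hp ▸ Finset.sum_le_sum_of_subset_of_nonneg (Finset.subset_univ _)
    fun a _ _ => hp0 a
  -- The point of the unit circle at distance √s from 1.
  set ζ : ℂ := ⟨1 - s / 2, √(s - s ^ 2 / 4)⟩ with hζ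
  have hsq : √(s - s ^ 2 / 4) ^ 2 = s - s ^ 2 / 4 := Real.sq_sqrt (by nlinarith)
  have hζ1 : ‖ζ‖ = 1 := by
    rw [← sq_eq_sq₀ (norm_nonneg _) zero_le_one, ← Complex.normSq_eq_norm_sq,
      Complex.normSq_apply]
    simp only [hζ]
    nlinarith
  have hζs : ‖ζ - 1‖ = √s := by
    rw [← sq_eq_sq₀ (norm_nonneg _) (Real.sqrt_nonneg _), ← Complex.normSq_eq_norm_sq,
      Complex.normSq_apply, Real.sq_sqrt hs0]
    simp only [hζ, Complex.sub_re, Complex.sub_im, Complex.one_re, Complex.one_im]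
    nlinarith
  set u : ξ → ℂ := fun a => if a ∈ A then ζ else 1 with hu
  have hu1 : ∀ a, ‖u a‖ = 1 := fun a => by simp only [hu]; split_ifs; exacts [hζ1, norm_one]
  have hu2 : ∀ f : ξ → ℝ, ∑ a, (f a : ℂ) * u a
      = ((∑ a, f a : ℝ) : ℂ) + (ζ - 1) * ((∑ a ∈ A, f a : ℝ) : ℂ) := fun f => by
    push_cast
    rw [Finset.mul_sum, ← Finset.sum_filter_add_sum_filter_not Finset.univ (· ∈ A),
      ← Finset.sum_filter_add_sum_filter_not Finset.univ (· ∈ A) (fun a => (f a : ℂ)),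
      Finset.filter_mem_eq_inter, Finset.univ_inter,
      Finset.sum_congr rfl (g := fun a => (f a : ℂ) + (ζ - 1) * f a)
        (fun a ha => by simp only [hu, ha, if_true]; ring),
      Finset.sum_add_distrib,
      Finset.sum_congr (s₁ := Finset.univ.filter fun a => a ∉ A) rfl (g := fun a => (f a : ℂ))
        (fun a ha => by simp [hu, (Finset.mem_filter.1 ha).2])]
    ring
  -- The squared modulus of the mean of `u` is 1 - s q (1 - q), at least 1 - 1/M by `hs`.
  have hEu : Real.exp (-1) ≤ ‖∑ a, (p a : ℂ) * u a‖ ^ (2 * (M - 1)) := by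
    rw [pow_mul]
    refine (exp_neg_one_le_one_sub_inv_pow hM).trans (pow_le_pow_left₀ ?_ ?_ _)
    · rw [sub_nonneg, div_le_one hMp]
      exact_mod_cast hM
    · rw [hu2, hp, ← hq, ← Complex.normSq_eq_norm_sq, Complex.normSq_apply]
      have h1 : q * s ≤ 1 / M := by rw [le_div_iff₀ hMp]; linarith
      simp only [hζ, Complex.add_re, Complex.add_im, Complex.mul_re, Complex.mul_im,
        Complex.sub_re, Complex.sub_im, Complex.one_re, Complex.one_im, Complex.ofReal_re,
        Complex.ofReal_im]
      have h2 : (1 + ((1 - s / 2 - 1) * q - (√(s - s ^ 2 / 4) - 0) * 0)) *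
          (1 + ((1 - s / 2 - 1) * q - (√(s - s ^ 2 / 4) - 0) * 0)) +
          (0 + ((1 - s / 2 - 1) * 0 + (√(s - s ^ 2 / 4) - 0) * q)) *
          (0 + ((1 - s / 2 - 1) * 0 + (√(s - s ^ 2 / 4) - 0) * q))
          = (1 - s * q / 2) ^ 2 + √(s - s ^ 2 / 4) ^ 2 * q ^ 2 := by ring
      rw [h2, hsq]
      nlinarith [mul_nonneg hs0 (sq_nonneg q)]
  have hEu' : 1 / 2 ≤ ‖∑ a, (p a : ℂ) * u a‖ ^ (M - 1) := by
    have h0 : 0 ≤ ‖∑ a, (p a : ℂ) * u a‖ ^ (M - 1) := by positivity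
    refine le_of_sq_le_sq ?_ h0
    rw [← pow_mul, mul_comm (M - 1) 2]
    refine le_trans ?_ hEu
    rw [Real.exp_neg, one_div, inv_pow]
    exact inv_anti₀ (Real.exp_pos _) (by linarith [Real.exp_one_lt_d9])
  -- In the term of codeword j, the other M - 1 codewords each contribute the mean of `u`; centring
  -- leaves only the `ζ - 1` part of the j-th factor.
  have hcalc : ∑ c : Fin M → ξ, (∏ j, ((p (c j) : ℂ) * u (c j))) *
      ((1 / (M : ℝ) * ∑ j, v (c j) - μ : ℝ) : ℂ)
      = (ζ - 1) * ((∑ a ∈ A, p a * (v a - μ) : ℝ) : ℂ) * (∑ a, (p a : ℂ) * u a) ^ (M - 1) := by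
    have h1 : ∀ c : Fin M → ξ, ((1 / (M : ℝ) * ∑ j, v (c j) - μ : ℝ) : ℂ)
        = 1 / (M : ℂ) * ∑ j, ((v (c j) - μ : ℝ) : ℂ) := fun c => by
      have : (M : ℂ) ≠ 0 := by exact_mod_cast hMp.ne'
      push_cast
      rw [Finset.sum_sub_distrib]
      simp only [Finset.sum_const, Finset.card_univ, Fintype.card_fin, nsmul_eq_mul]
      field_simp
    simp_rw [h1, mul_left_comm _ (1 / (M : ℂ)), ← Finset.mul_sum, Finset.mul_sum]
    rw [Finset.sum_comm]
    have h2 : ∀ j : Fin M, ∑ c : Fin M → ξ, (1 / (M : ℂ)) * ((∏ j, ((p (c j) : ℂ) * u (c j))) *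
        ((v (c j) - μ : ℝ) : ℂ)) = 1 / (M : ℂ) * ((ζ - 1) * ((∑ a ∈ A, p a * (v a - μ) : ℝ) : ℂ)
          * (∑ a, (p a : ℂ) * u a) ^ (M - 1)) := fun j => by
      rw [← Finset.mul_sum, sum_pi_prod_mul_apply (fun _ a => (p a : ℂ) * u a) j
        (fun a => ((v a - μ : ℝ) : ℂ))]
      have h3 := hu2 (fun a => p a * (v a - μ))
      have h4 : ∑ a, p a * (v a - μ) = 0 := by
        simp_rw [mul_sub, Finset.sum_sub_distrib, ← Finset.sum_mul, hp]
        simp [hμ]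
      rw [h4, Complex.ofReal_zero, zero_add] at h3
      rw [← h3]
      congr 2
      · refine Finset.sum_congr rfl fun a _ => ?_
        push_cast
        ring
      · rw [Finset.prod_const, Finset.card_erase_of_mem (Finset.mem_univ _)]
        simp
    simp_rw [h2]
    have : (M : ℂ) ≠ 0 := by exact_mod_cast hMp.ne'
    simp only [Finset.sum_const, Finset.card_univ, Fintype.card_fin, nsmul_eq_mul]
    field_simp
  have hnorm : ‖∑ c : Fin M → ξ, (∏ j, ((p (c j) : ℂ) * u (c j))) *
      ((1 / (M : ℝ) * ∑ j, v (c j) - μ : ℝ) : ℂ)‖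
      ≤ codebookExp p M (fun c => |1 / (M : ℝ) * ∑ j, v (c j) - μ|) := by
    refine (norm_sum_le _ _).trans (Finset.sum_le_sum fun c _ => ?_)
    rw [norm_mul, norm_prod, Complex.norm_real, Real.norm_eq_abs]
    refine mul_le_mul_of_nonneg_right (le_of_eq ?_) (abs_nonneg _)
    refine Finset.prod_congr rfl fun j _ => ?_
    rw [norm_mul, hu1, mul_one, Complex.norm_real, Real.norm_of_nonneg (hp0 _)]
  refine le_trans ?_ hnorm
  rw [hcalc, norm_mul, norm_mul, hζs, norm_pow, Complex.norm_real, Real.norm_eq_abs]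
  have h5 := le_abs_self (∑ a ∈ A, p a * (v a - μ))
  have h6 := Real.sqrt_nonneg s
  calc 1 / 2 * √s * ∑ a ∈ A, p a * (v a - μ)
      ≤ 1 / 2 * √s * |∑ a ∈ A, p a * (v a - μ)| := by gcongr
    _ = √s * |∑ a ∈ A, p a * (v a - μ)| * (1 / 2) := by ring
    _ ≤ _ := by gcongr

end Codebook

/-! ### Type classes and comparison of the constant-composition law with the product law. -/

section Types

variable {X : Type*} [Fintype X]

theorem IsType.exists_counts {m : ℕ} (hm : 0 < m) {P : X → ℝ} (hP : IsType m P) (k : ℕ) :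
    ∃ N : X → ℕ, (∀ a, (N a : ℝ) = ((m * k : ℕ) : ℝ) * P a) ∧ ∑ a, N a = m * k := by
  choose j _ hj using hP.2
  have hm' : (m : ℝ) ≠ 0 := by positivity
  have h : ∀ a, ((j a * k : ℕ) : ℝ) = ((m * k : ℕ) : ℝ) * P a := fun a => by
    rw [hj a]; push_cast; field_simp
  refine ⟨fun a => j a * k, h, ?_⟩
  have : ((∑ a, j a * k : ℕ) : ℝ) = ((m * k : ℕ) : ℝ) := by
    rw [Nat.cast_sum, Finset.sum_congr rfl fun a _ => h a, ← Finset.mul_sum, hP.1.2, mul_one]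
  exact_mod_cast this

open scoped Classical in
theorem mem_typeClass_iff {n : ℕ} (hn : 0 < n) {P : X → ℝ} {N : X → ℕ}
    (hN : ∀ a, (N a : ℝ) = (n : ℝ) * P a) (x : Fin n → X) :
    x ∈ typeClass n P ↔ ∀ a, (Finset.univ.filter fun i => x i = a).card = N a := by
  have hn' : (n : ℝ) ≠ 0 := by positivity
  simp only [typeClass, Finset.mem_filter, Finset.mem_univ, true_and, funext_iff, empDist]
  refine forall_congr' fun a => ?_
  rw [div_eq_iff hn', ← @Nat.cast_inj ℝ _ _ _ (N a), hN, mul_comm (P a)]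

theorem sum_apply_of_mem_typeClass {n : ℕ} (hn : 0 < n) {P : X → ℝ} {x : Fin n → X}
    (hx : x ∈ typeClass n P) (g : X → ℝ) : ∑ i, g (x i) = n * ∑ a, P a * g a := by
  classical
  have hn' : (n : ℝ) ≠ 0 := by positivity
  simp only [typeClass, Finset.mem_filter, Finset.mem_univ, true_and] at hx
  rw [← Finset.sum_fiberwise' Finset.univ x g, Finset.mul_sum]
  refine Finset.sum_congr rfl fun a _ => ?_
  rw [← hx, Finset.sum_const, nsmul_eq_mul, empDist]
  field_simp

theorem apply_ne_zero_of_mem_typeClass {n : ℕ} {P : X → ℝ} {x : Fin n → X}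
    (hx : x ∈ typeClass n P) (i : Fin n) : P (x i) ≠ 0 := by
  classical
  have hn : 0 < n := i.pos
  simp only [typeClass, Finset.mem_filter, Finset.mem_univ, true_and] at hx
  rw [← hx, empDist]
  have : 0 < (Finset.univ.filter fun j => x j = x i).card :=
    Finset.card_pos.2 ⟨i, by simp⟩
  positivity

theorem typeClass_nonempty {m k : ℕ} (hm : 0 < m) (hk : 0 < k) {P : X → ℝ} (hP : IsType m P) :
    (typeClass (m * k) P).Nonempty := by
  classical
  obtain ⟨N, hN, hNs⟩ := hP.exists_counts hm k
  have hc : Fintype.card (Fin (m * k)) = Fintype.card (Σ a, Fin (N a)) := by simp [hNs]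
  let e := Fintype.equivOfCardEq hc
  refine ⟨fun i => (e i).1, (mem_typeClass_iff (by positivity) hN _).2 fun a => ?_⟩
  rw [← Fintype.card_subtype]
  rw [← Fintype.card_fin (N a)]
  exact Fintype.card_congr ((e.subtypeEquiv fun i => Iff.rfl).trans
    (Equiv.sigmaSubtype a))

/-- Permutations of positions send one sequence of the class into the class, and each fibre of this
map embeds in a stabilizer of size ∏ N(a)!. -/
theorem factorial_le_card_typeClass_mul {n : ℕ} (hn : 0 < n) {P : X → ℝ} {N : X → ℕ}
    (hN : ∀ a, (N a : ℝ) = (n : ℝ) * P a) (hT : (typeClass n P).Nonempty) :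
    n.factorial ≤ (∏ a, (N a).factorial) * (typeClass n P).card := by
  classical
  obtain ⟨x, hx⟩ := hT
  have hxN := (mem_typeClass_iff hn hN x).1 hx
  have hst : Fintype.card {g : Equiv.Perm (Fin n) // x ∘ g = x} = ∏ a, (N a).factorial := by
    rw [DomMulAct.stabilizer_card]
    refine Finset.prod_congr rfl fun a _ => ?_
    rw [Fintype.card_subtype, ← hxN a]
  have hcard : n.factorial = (Finset.univ : Finset (Equiv.Perm (Fin n))).card := by
    rw [Finset.card_univ, Fintype.card_perm, Fintype.card_fin]
  rw [hcard]
  refine (Finset.card_le_mul_card_image (f := fun g : Equiv.Perm (Fin n) => x ∘ g)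
    (s := Finset.univ) (∏ a, (N a).factorial) ?_).trans ?_
  · intro y hy
    obtain ⟨g₀, _, rfl⟩ := Finset.mem_image.1 hy
    rw [← hst, Fintype.card_subtype]
    refine Finset.card_le_card_of_injOn (fun g => g * g₀⁻¹) ?_ ?_
    · intro g hg
      simp only [Finset.coe_filter, Finset.mem_univ, true_and, Set.mem_ofPred_eq] at hg ⊢
      funext i
      simpa using congrFun hg (g₀⁻¹ i)
    · intro g _ g' _ h
      simpa using h
  · refine Nat.mul_le_mul_left _ (Finset.card_le_card fun y hy => ?_)
    obtain ⟨g, _, rfl⟩ := Finset.mem_image.1 hy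
    rw [mem_typeClass_iff hn hN]
    intro a
    rw [← hxN a, ← Finset.card_map g.toEmbedding]
    congr 1
    ext i
    simp only [Finset.mem_map, Finset.mem_filter, Finset.mem_univ, true_and, Function.comp_apply,
      Equiv.coe_toEmbedding]
    exact ⟨fun ⟨j, hj, h⟩ => h ▸ hj, fun h => ⟨g.symm i, by simpa using h, by simp⟩⟩

/-- A crude Stirling bound. The induction runs on `k + 1` with the sharper prefactor e(k+1), since
e·k·k^k fails at k = 0; its step is 1 - 1/(k+2) ≤ exp(-1/(k+2)) raised to the power k + 2. -/
theorem factorial_mul_exp_le (k : ℕ) :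
    (k.factorial : ℝ) * Real.exp k ≤ Real.exp 1 * (k + 1) * (k : ℝ) ^ k := by
  have key : ∀ k : ℕ, ((k + 1).factorial : ℝ) * Real.exp ((k : ℝ) + 1)
      ≤ Real.exp 1 * (k + 1) * ((k : ℝ) + 1) ^ (k + 1) := by
    intro k
    induction k with
    | zero => simp
    | succ k ih =>
      have h1 : Real.exp 1 * ((k : ℝ) + 1) ^ (k + 2) ≤ ((k : ℝ) + 2) ^ (k + 2) := by
        have h := Real.add_one_le_exp (-(1 / ((k : ℝ) + 2)))
        have h2 : ((k : ℝ) + 1) / (k + 2) ≤ Real.exp (-(1 / ((k : ℝ) + 2))) := by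
          refine le_trans (le_of_eq ?_) h
          field_simp
          ring
        have h3 := pow_le_pow_left₀ (by positivity) h2 (k + 2)
        rw [← Real.exp_nat_mul, div_pow, div_le_iff₀ (by positivity)] at h3
        have h4 : ((k + 2 : ℕ) : ℝ) * -(1 / ((k : ℝ) + 2)) = -1 := by
          push_cast
          field_simp
        rw [h4, Real.exp_neg, inv_mul_eq_div, le_div_iff₀ (Real.exp_pos _)] at h3
        linarith
      rw [Nat.factorial_succ]
      push_cast
      calc ((k : ℝ) + 1 + 1) * ((k + 1).factorial : ℝ) * Real.exp ((k : ℝ) + 1 + 1)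
          = (k + 2) * Real.exp 1 * (((k + 1).factorial : ℝ) * Real.exp ((k : ℝ) + 1)) := by
            rw [Real.exp_add ((k : ℝ) + 1) 1]; ring
        _ ≤ (k + 2) * Real.exp 1 * (Real.exp 1 * (k + 1) * ((k : ℝ) + 1) ^ (k + 1)) := by gcongr
        _ = (k + 2) * Real.exp 1 * (Real.exp 1 * ((k : ℝ) + 1) ^ (k + 2)) := by ring
        _ ≤ (k + 2) * Real.exp 1 * ((k : ℝ) + 2) ^ (k + 2) := by gcongr
        _ = _ := by ring
  cases k with
  | zero => simp
  | succ k =>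
    push_cast
    refine (key k).trans ?_
    gcongr
    linarith

theorem ccDist_nonneg (n : ℕ) (P : X → ℝ) (x : Fin n → X) : 0 ≤ ccDist n P x := by
  unfold ccDist
  split_ifs <;> positivity

theorem sum_ccDist {n : ℕ} {P : X → ℝ} (hT : (typeClass n P).Nonempty) :
    ∑ x, ccDist n P x = 1 := by
  classical
  have h : ((typeClass n P).card : ℝ) ≠ 0 := by exact_mod_cast hT.card_pos.ne'
  simp [ccDist, h]

theorem sum_ccDist_mul_le {n : ℕ} {P : X → ℝ} (hT : (typeClass n P).Nonempty)
    (f : (Fin n → X) → ℝ) (r : ℝ) (h : ∀ x ∈ typeClass n P, f x ≤ r) :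
    ∑ x, ccDist n P x * f x ≤ r := by
  calc ∑ x, ccDist n P x * f x ≤ ∑ x, ccDist n P x * r := by
        refine Finset.sum_le_sum fun x _ => ?_
        by_cases hx : x ∈ typeClass n P
        · exact mul_le_mul_of_nonneg_left (h x hx) (ccDist_nonneg n P x)
        · simp [ccDist, hx]
    _ = r := by rw [← Finset.sum_mul, sum_ccDist hT, one_mul]

/-- Up to a polynomial factor, the constant-composition distribution is dominated by the
product distribution. -/
theorem ccDist_le_prod {n : ℕ} (hn0 : 0 < n) {P : X → ℝ} (hP0 : ∀ a, 0 ≤ P a) {N : X → ℕ}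
    (hN : ∀ a, (N a : ℝ) = (n : ℝ) * P a) (hNs : ∑ a, N a = n) (hT : (typeClass n P).Nonempty)
    (x : Fin n → X) :
    ccDist n P x ≤ (Real.exp 1 * ((n : ℝ) + 1)) ^ Fintype.card X * ∏ i, P (x i) := by
  classical
  have hnr : (0 : ℝ) < n := by positivity
  by_cases hx : x ∈ typeClass n P
  swap
  · simp only [ccDist, hx, if_false]
    have : 0 ≤ ∏ i, P (x i) := Finset.prod_nonneg fun i _ => hP0 _
    positivity
  simp only [ccDist, hx, if_true]
  have hprod : ∏ i, P (x i) = (∏ a, (N a : ℝ) ^ N a) / (n : ℝ) ^ n := by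
    have hpow : (n : ℝ) ^ n = ∏ a, (n : ℝ) ^ N a := by
      rw [Finset.prod_pow_eq_pow_sum, hNs]
    rw [← Finset.prod_fiberwise' Finset.univ x P, hpow, ← Finset.prod_div_distrib]
    refine Finset.prod_congr rfl fun a _ => ?_
    rw [Finset.prod_const, (mem_typeClass_iff hn0 hN x).1 hx a, hN a, ← div_pow]
    congr 1
    field_simp
  have h1 : ((n : ℝ)) ^ n ≤ n.factorial * Real.exp n := by
    have := Real.pow_div_factorial_le_exp (x := (n : ℝ)) (by positivity) n
    rwa [div_le_iff₀ (by positivity), mul_comm] at this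
  have h2 : (n.factorial : ℝ) ≤ (∏ a, ((N a).factorial : ℝ)) * (typeClass n P).card := by
    exact_mod_cast factorial_le_card_typeClass_mul hn0 hN hT
  -- Stirling letter by letter, at a cost of at most e(n+1) per letter.
  have h3 : (∏ a, ((N a).factorial : ℝ)) * Real.exp n
      ≤ (Real.exp 1 * ((n : ℝ) + 1)) ^ Fintype.card X * ∏ a, (N a : ℝ) ^ N a := by
    have : Real.exp n = ∏ a, Real.exp (N a) := by rw [← Real.exp_sum, ← hNs]; push_cast; rfl
    rw [this, ← Finset.prod_mul_distrib, ← Finset.card_univ, ← Finset.prod_const,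
      ← Finset.prod_mul_distrib]
    refine Finset.prod_le_prod (fun a _ => by positivity) fun a _ => ?_
    refine (factorial_mul_exp_le (N a)).trans ?_
    have : (N a : ℝ) ≤ n := by
      rw [← hNs]
      exact_mod_cast Finset.single_le_sum (f := N) (fun a _ => Nat.zero_le _) (Finset.mem_univ a)
    gcongr
  have hc : (0 : ℝ) < (typeClass n P).card := by exact_mod_cast hT.card_pos
  rw [hprod, div_le_iff₀ hc, mul_div_assoc', div_mul_eq_mul_div, le_div_iff₀ (by positivity),
    one_mul]
  calc (n : ℝ) ^ n ≤ n.factorial * Real.exp n := h1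
    _ ≤ ((∏ a, ((N a).factorial : ℝ)) * (typeClass n P).card) * Real.exp n := by gcongr
    _ = ((∏ a, ((N a).factorial : ℝ)) * Real.exp n) * (typeClass n P).card := by ring
    _ ≤ _ := by gcongr

theorem eventually_const_mul_pow_le_exp (C : ℝ) (d : ℕ) {δ : ℝ} (hδ : 0 < δ) :
    ∀ᶠ n : ℕ in atTop, (C * ((n : ℝ) + 1)) ^ d ≤ Real.exp (n * δ) := by
  have h1 : Tendsto (fun n : ℕ => ((n : ℝ) + 1) ^ d * Real.exp (-(δ * ((n : ℝ) + 1))))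
      atTop (𝓝 0) := by
    have := tendsto_rpow_mul_exp_neg_mul_atTop_nhds_zero d δ hδ
    have h2 : Tendsto (fun n : ℕ => (n : ℝ) + 1) atTop atTop :=
      tendsto_atTop_add_const_right _ _ tendsto_natCast_atTop_atTop
    refine (this.comp h2).congr fun n => ?_
    simp [Function.comp, Real.rpow_natCast]
  have h3 := h1.const_mul (|C| ^ d)
  rw [mul_zero] at h3
  filter_upwards [h3.eventually (gt_mem_nhds (Real.exp_pos (-δ)))] with n hn
  have hle : (C * ((n : ℝ) + 1)) ^ d ≤ |C| ^ d * ((n : ℝ) + 1) ^ d := by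
    rw [← mul_pow]
    refine (le_abs_self _).trans ?_
    rw [abs_pow, abs_mul, abs_of_nonneg (by positivity : (0 : ℝ) ≤ n + 1)]
  refine hle.trans ?_
  have e : Real.exp (n * δ) = Real.exp (-δ) * Real.exp (δ * ((n : ℝ) + 1)) := by
    rw [← Real.exp_add]; congr 1; ring
  rw [e, ← div_le_iff₀ (Real.exp_pos _), div_eq_mul_inv, ← Real.exp_neg, mul_assoc]
  exact hn.le

end Types

/-! ### Minimax by separation in the plane. -/

section Minimax

variable {E : Type*} [AddCommGroup E] [Module ℝ E] [TopologicalSpace E]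

/-- A minimax theorem for two convex functions on a compact convex set. -/
theorem exists_minimax_pair {K : Set E} (hK : IsCompact K) (hne : K.Nonempty) {F₀ F₁ : E → ℝ}
    (h₀ : ConvexOn ℝ K F₀) (h₁ : ConvexOn ℝ K F₁) (c₀ : ContinuousOn F₀ K)
    (c₁ : ContinuousOn F₁ K) :
    ∃ q ∈ K, ∃ t ∈ Set.Icc (0 : ℝ) 1, (∀ q' ∈ K, max (F₀ q) (F₁ q) ≤ max (F₀ q') (F₁ q')) ∧
      ∀ q' ∈ K, max (F₀ q) (F₁ q) ≤ (1 - t) * F₀ q' + t * F₁ q' := by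
  obtain ⟨q, hq, hmin⟩ := hK.exists_isMinOn hne (c₀.sup c₁)
  have hmin' : ∀ q' ∈ K, max (F₀ q) (F₁ q) ≤ max (F₀ q') (F₁ q') := fun q' hq' => hmin hq'
  set v := max (F₀ q) (F₁ q) with hv
  -- The upward closure of the image of (F₀, F₁): convex, and disjoint from the open quadrant below
  -- (v, v). Being upward closed, it forces the separating functional to have nonnegative
  -- coefficients, whose normalization is the mixing weight.
  let A : Set (ℝ × ℝ) := {z | ∃ q ∈ K, F₀ q ≤ z.1 ∧ F₁ q ≤ z.2}
  have hA : Convex ℝ A := by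
    rintro z ⟨q₁, hq₁, h11, h12⟩ w ⟨q₂, hq₂, h21, h22⟩ a b ha hb hab
    refine ⟨a • q₁ + b • q₂, h₀.1 hq₁ hq₂ ha hb hab, ?_, ?_⟩
    · refine (h₀.2 hq₁ hq₂ ha hb hab).trans ?_
      simp only [smul_eq_mul, Prod.fst_add, Prod.smul_fst]
      gcongr
    · refine (h₁.2 hq₁ hq₂ ha hb hab).trans ?_
      simp only [smul_eq_mul, Prod.snd_add, Prod.smul_snd]
      gcongr
  have hdisj : Disjoint (Set.Iio v ×ˢ Set.Iio v) A := by
    rw [Set.disjoint_left]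
    rintro z ⟨hz1, hz2⟩ ⟨q', hq', h1, h2⟩
    have := hmin' q' hq'
    simp only [Set.mem_Iio] at hz1 hz2
    exact absurd (max_lt (h1.trans_lt hz1) (h2.trans_lt hz2)) (not_lt.2 this)
  obtain ⟨f, u, hfB, hfA⟩ := geometric_hahn_banach_open
    ((convex_Iio v).prod (convex_Iio v)) (isOpen_Iio.prod isOpen_Iio) hA hdisj
  set s := f (1, 0) with hs
  set r := f (0, 1) with hr
  have hf : ∀ a b : ℝ, f (a, b) = a * s + b * r := fun a b => by
    have : ((a, b) : ℝ × ℝ) = a • ((1, 0) : ℝ × ℝ) + b • ((0, 1) : ℝ × ℝ) := by simp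
    rw [this, map_add, map_smul, map_smul, smul_eq_mul, smul_eq_mul]
  have hB : ∀ d, 0 < d → (v - d) * s + (v - d) * r < u := fun d hd => by
    rw [← hf]
    exact hfB _ ⟨by simp [hd], by simp [hd]⟩
  have hA' : ∀ q' ∈ K, ∀ a b : ℝ, 0 ≤ a → 0 ≤ b → u ≤ (F₀ q' + a) * s + (F₁ q' + b) * r :=
    fun q' hq' a b ha hb => by
      rw [← hf]
      exact hfA _ ⟨q', hq', by simp [ha], by simp [hb]⟩
  have hs0 : 0 ≤ s := by
    by_contra hneg
    push Not at hneg
    have h := hA' q hq ((|F₀ q * s + F₁ q * r| + |u| + 1) / (-s)) 0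
      (div_nonneg (by positivity) (by linarith)) le_rfl
    have h2 : (|F₀ q * s + F₁ q * r| + |u| + 1) / (-s) * s
        = -(|F₀ q * s + F₁ q * r| + |u| + 1) := by field_simp [hneg.ne]
    nlinarith [le_abs_self (F₀ q * s + F₁ q * r), neg_abs_le u]
  have hr0 : 0 ≤ r := by
    by_contra hneg
    push Not at hneg
    have h := hA' q hq 0 ((|F₀ q * s + F₁ q * r| + |u| + 1) / (-r)) le_rfl
      (div_nonneg (by positivity) (by linarith))
    have h2 : (|F₀ q * s + F₁ q * r| + |u| + 1) / (-r) * r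
        = -(|F₀ q * s + F₁ q * r| + |u| + 1) := by field_simp [hneg.ne]
    nlinarith [le_abs_self (F₀ q * s + F₁ q * r), neg_abs_le u]
  have hsr : 0 < s + r := by
    rcases (add_nonneg hs0 hr0).eq_or_lt with h | h
    · have hs1 : s = 0 := by linarith
      have hr1 : r = 0 := by linarith
      have h1 := hB 1 one_pos
      have h2 := hA' q hq 0 0 le_rfl le_rfl
      rw [hs1, hr1] at h1 h2
      linarith
    · exact h
  have hu : v * (s + r) ≤ u := by
    by_contra hlt
    push Not at hlt
    have h := hB ((v * (s + r) - u) / (s + r)) (div_pos (by linarith) hsr)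
    have h2 : (v * (s + r) - u) / (s + r) * (s + r) = v * (s + r) - u := by field_simp
    linarith
  refine ⟨q, hq, r / (s + r), ⟨by positivity, ?_⟩, hmin', fun q' hq' => ?_⟩
  · rw [div_le_one hsr]; linarith
  · have h := hA' q' hq' 0 0 le_rfl le_rfl
    have h2 : (1 - r / (s + r)) * F₀ q' + r / (s + r) * F₁ q'
        = (F₀ q' * s + F₁ q' * r) / (s + r) := by field_simp; ring
    rw [h2, le_div_iff₀ hsr]
    linarith

end Minimax

/-! ### The Lagrangian and strong duality, in real-valued form. -/

noncomputable section

variable {X Y : Type*} [Fintype X] [Fintype Y]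

/-- Conditional relative entropy `D(Q ‖ W | P)` as a real number. -/
def condDiv (P : X → ℝ) (Q W : X → Y → ℝ) : ℝ :=
  ∑ x, ∑ y, P x * (Q x y * Real.log (Q x y / W x y))

/-- Mutual information as a real number. -/
def mutInf (P : X → ℝ) (Q : X → Y → ℝ) : ℝ := condDiv P Q fun _ => outputDist P Q

/-- `Q(·|x) ≪ W(·|x)` for all `x` in the support of `P`. -/
def Dominated (P : X → ℝ) (Q W : X → Y → ℝ) : Prop :=
  ∀ x y, P x ≠ 0 → W x y = 0 → Q x y = 0

/-- The channels with finite conditional relative entropy with respect to `W`. -/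
def dominatedChannels (P : X → ℝ) (W : X → Y → ℝ) : Set (X → Y → ℝ) :=
  {Q | IsChannel Q ∧ Dominated P Q W}

/-- Conditional entropy of the output given the input. -/
def condEnt (P : X → ℝ) (Q : X → Y → ℝ) : ℝ := ∑ x, ∑ y, P x * Real.negMulLog (Q x y)

/-- Under domination the divergence is minus an entropy plus a term linear in Q. Continuity and
convexity, hidden by the logarithm of a ratio, become visible. -/
theorem condDiv_eq {P : X → ℝ} {Q W : X → Y → ℝ} (h : Dominated P Q W) :
    condDiv P Q W = -condEnt P Q - ∑ x, ∑ y, P x * (Q x y * Real.log (W x y)) := by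
  simp only [condDiv, condEnt, ← Finset.sum_neg_distrib, ← Finset.sum_sub_distrib]
  refine Finset.sum_congr rfl fun x _ => Finset.sum_congr rfl fun y _ => ?_
  rw [Real.negMulLog]
  by_cases hP : P x = 0
  · simp [hP]
  by_cases hQ : Q x y = 0
  · simp [hQ]
  have hW : W x y ≠ 0 := fun hW => hQ (h x y hP hW)
  rw [Real.log_div hQ hW]
  ring

omit [Fintype Y] in
theorem outputDist_nonneg {P : X → ℝ} (hP : ∀ x, 0 ≤ P x) {Q : X → Y → ℝ} (hQ : ∀ x y, 0 ≤ Q x y)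
    (y : Y) : 0 ≤ outputDist P Q y :=
  Finset.sum_nonneg fun x _ => mul_nonneg (hP x) (hQ x y)

omit [Fintype Y] in
theorem dominated_outputDist {P : X → ℝ} (hP : ∀ x, 0 ≤ P x) {Q : X → Y → ℝ}
    (hQ : ∀ x y, 0 ≤ Q x y) : Dominated P Q fun _ => outputDist P Q := by
  intro x y hx hy
  have := (Finset.sum_eq_zero_iff_of_nonneg fun x _ => mul_nonneg (hP x) (hQ x y)).1 hy x
    (Finset.mem_univ x)
  exact (mul_eq_zero.1 this).resolve_left hx

theorem sum_mul_outputDist (P : X → ℝ) (Q : X → Y → ℝ) (g : Y → ℝ) :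
    ∑ y, outputDist P Q y * g y = ∑ x, ∑ y, P x * (Q x y * g y) := by
  rw [Finset.sum_comm]
  refine Finset.sum_congr rfl fun y _ => ?_
  rw [outputDist, Finset.sum_mul]
  exact Finset.sum_congr rfl fun x _ => by ring

theorem sum_outputDist {P : X → ℝ} (hP : ∑ x, P x = 1) {Q : X → Y → ℝ} (hQ : ∀ x, ∑ y, Q x y = 1) :
    ∑ y, outputDist P Q y = 1 := by
  have := sum_mul_outputDist P Q fun _ => 1
  simpa [← Finset.mul_sum, hQ, hP] using this

omit [Fintype Y] in
theorem outputDist_add (P : X → ℝ) (Q Q' : X → Y → ℝ) (a b : ℝ) (y : Y) :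
    outputDist P (a • Q + b • Q') y = a * outputDist P Q y + b * outputDist P Q' y := by
  simp only [outputDist, Finset.mul_sum, ← Finset.sum_add_distrib, Pi.add_apply, Pi.smul_apply,
    smul_eq_mul]
  exact Finset.sum_congr rfl fun x _ => by ring

theorem mutInf_eq {P : X → ℝ} (hP : ∀ x, 0 ≤ P x) {Q : X → Y → ℝ} (hQ : ∀ x y, 0 ≤ Q x y) :
    mutInf P Q = ∑ y, Real.negMulLog (outputDist P Q y) - condEnt P Q := by
  rw [mutInf, condDiv_eq (dominated_outputDist hP hQ), ← sum_mul_outputDist P Q]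
  simp only [Real.negMulLog, neg_mul, Finset.sum_neg_distrib]
  ring

theorem negMulLog_add_le {a b p q : ℝ} (ha : 0 ≤ a) (hb : 0 ≤ b) (hab : a + b = 1) (hp : 0 ≤ p)
    (hq : 0 ≤ q) :
    a * Real.negMulLog p + b * Real.negMulLog q ≤ Real.negMulLog (a * p + b * q) := by
  simpa using Real.concaveOn_negMulLog.2 (Set.mem_Ici.2 hp) (Set.mem_Ici.2 hq) ha hb hab

theorem condEnt_add_le {P : X → ℝ} (hP : ∀ x, 0 ≤ P x) {Q Q' : X → Y → ℝ} (hQ : ∀ x y, 0 ≤ Q x y)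
    (hQ' : ∀ x y, 0 ≤ Q' x y) {a b : ℝ} (ha : 0 ≤ a) (hb : 0 ≤ b) (hab : a + b = 1) :
    a * condEnt P Q + b * condEnt P Q' ≤ condEnt P (a • Q + b • Q') := by
  simp only [condEnt, Finset.mul_sum, ← Finset.sum_add_distrib]
  refine Finset.sum_le_sum fun x _ => Finset.sum_le_sum fun y _ => ?_
  have := mul_le_mul_of_nonneg_left (negMulLog_add_le ha hb hab (hQ x y) (hQ' x y)) (hP x)
  simp only [Pi.add_apply, Pi.smul_apply, smul_eq_mul]
  linarith

omit [Fintype X] [Fintype Y] in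
theorem Dominated.add {P : X → ℝ} {Q Q' W : X → Y → ℝ} (h : Dominated P Q W)
    (h' : Dominated P Q' W) (a b : ℝ) : Dominated P (a • Q + b • Q') W := by
  intro x y hx hy
  simp [h x y hx hy, h' x y hx hy]

omit [Fintype X] in
theorem IsChannel.add {Q Q' : X → Y → ℝ} (h : IsChannel Q) (h' : IsChannel Q') {a b : ℝ}
    (ha : 0 ≤ a) (hb : 0 ≤ b) (hab : a + b = 1) : IsChannel (a • Q + b • Q') := fun x =>
  convex_stdSimplex ℝ Y (h x) (h' x) ha hb hab

omit [Fintype X] in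
theorem convex_dominatedChannels (P : X → ℝ) (W : X → Y → ℝ) :
    Convex ℝ (dominatedChannels P W) := fun _ hQ _ hQ' a b ha hb hab =>
  ⟨hQ.1.add hQ'.1 ha hb hab, hQ.2.add hQ'.2 a b⟩

omit [Fintype X] in
theorem isCompact_dominatedChannels (P : X → ℝ) (W : X → Y → ℝ) :
    IsCompact (dominatedChannels P W) := by
  have h1 : IsCompact (Set.univ.pi fun _ : X => stdSimplex ℝ Y) :=
    isCompact_univ_pi fun _ => isCompact_stdSimplex ℝ Y
  have h2 : IsClosed {Q : X → Y → ℝ | Dominated P Q W} := by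
    simp only [Dominated, Set.ofPred_forall]
    refine isClosed_iInter fun x => isClosed_iInter fun y => isClosed_iInter fun _ =>
      isClosed_iInter fun _ => ?_
    exact isClosed_eq (by fun_prop) continuous_const
  convert h1.inter_right h2 using 1
  ext Q
  simp [dominatedChannels, IsChannel]

theorem condDiv_add_le {P : X → ℝ} (hP : ∀ x, 0 ≤ P x) {Q Q' W : X → Y → ℝ}
    (hQ : ∀ x y, 0 ≤ Q x y) (hQ' : ∀ x y, 0 ≤ Q' x y) (h : Dominated P Q W)
    (h' : Dominated P Q' W) {a b : ℝ} (ha : 0 ≤ a) (hb : 0 ≤ b) (hab : a + b = 1) :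
    condDiv P (a • Q + b • Q') W ≤ a * condDiv P Q W + b * condDiv P Q' W := by
  rw [condDiv_eq h, condDiv_eq h', condDiv_eq (h.add h' a b)]
  have h1 := condEnt_add_le hP hQ hQ' ha hb hab
  have h2 : ∑ x, ∑ y, P x * ((a • Q + b • Q') x y * Real.log (W x y))
      = a * ∑ x, ∑ y, P x * (Q x y * Real.log (W x y))
        + b * ∑ x, ∑ y, P x * (Q' x y * Real.log (W x y)) := by
    simp only [Finset.mul_sum, ← Finset.sum_add_distrib, Pi.add_apply, Pi.smul_apply, smul_eq_mul]
    exact Finset.sum_congr rfl fun x _ => Finset.sum_congr rfl fun y _ => by ring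
  rw [h2]
  linarith

/-- The Lagrangian `D(Q ‖ W | P) + r (R - I(P, Q))` of the primal problem. -/
def lagrangian (R : ℝ) (P : X → ℝ) (W : X → Y → ℝ) (r : ℝ) (Q : X → Y → ℝ) : ℝ :=
  condDiv P Q W + r * (R - mutInf P Q)

/-- For 0 ≤ r ≤ 1 both entropies carry nonpositive coefficients and the rest is affine in Q, hence
convexity, although R - I alone is not convex. -/
theorem lagrangian_eq {R : ℝ} {P : X → ℝ} (hP : ∀ x, 0 ≤ P x) {W : X → Y → ℝ} (r : ℝ)
    {Q : X → Y → ℝ} (hQ : Q ∈ dominatedChannels P W) :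
    lagrangian R P W r Q = -(1 - r) * condEnt P Q - r * ∑ y, Real.negMulLog (outputDist P Q y)
      - ∑ x, ∑ y, P x * (Q x y * Real.log (W x y)) + r * R := by
  rw [lagrangian, condDiv_eq hQ.2, mutInf_eq hP fun x => (hQ.1 x).1]
  ring

theorem continuousOn_lagrangian {R : ℝ} {P : X → ℝ} (hP : ∀ x, 0 ≤ P x) {W : X → Y → ℝ} (r : ℝ) :
    ContinuousOn (lagrangian R P W r) (dominatedChannels P W) := by
  refine ContinuousOn.congr (Continuous.continuousOn ?_) fun Q hQ => lagrangian_eq hP r hQ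
  have h := Real.continuous_negMulLog
  unfold condEnt outputDist
  fun_prop

theorem convexOn_lagrangian {R : ℝ} {P : X → ℝ} (hP : ∀ x, 0 ≤ P x) {W : X → Y → ℝ} {r : ℝ}
    (hr0 : 0 ≤ r) (hr1 : r ≤ 1) :
    ConvexOn ℝ (dominatedChannels P W) (lagrangian R P W r) := by
  refine ⟨convex_dominatedChannels P W, fun Q hQ Q' hQ' a b ha hb hab => ?_⟩
  have hQ0 : ∀ x y, 0 ≤ Q x y := fun x => (hQ.1 x).1
  have hQ0' : ∀ x y, 0 ≤ Q' x y := fun x => (hQ'.1 x).1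
  have hc := condDiv_add_le hP hQ0 hQ0' hQ.2 hQ'.2 ha hb hab
  have hE := condEnt_add_le hP hQ0 hQ0' ha hb hab
  rw [lagrangian_eq hP r hQ, lagrangian_eq hP r hQ',
    lagrangian_eq hP r (convex_dominatedChannels P W hQ hQ' ha hb hab)]
  have h2 : ∑ x, ∑ y, P x * ((a • Q + b • Q') x y * Real.log (W x y))
      = a * ∑ x, ∑ y, P x * (Q x y * Real.log (W x y))
        + b * ∑ x, ∑ y, P x * (Q' x y * Real.log (W x y)) := by
    simp only [Finset.mul_sum, ← Finset.sum_add_distrib, Pi.add_apply, Pi.smul_apply, smul_eq_mul]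
    exact Finset.sum_congr rfl fun x _ => Finset.sum_congr rfl fun y _ => by ring
  have h3 : a * ∑ y, Real.negMulLog (outputDist P Q y)
      + b * ∑ y, Real.negMulLog (outputDist P Q' y)
      ≤ ∑ y, Real.negMulLog (outputDist P (a • Q + b • Q') y) := by
    simp only [Finset.mul_sum, ← Finset.sum_add_distrib, outputDist_add]
    exact Finset.sum_le_sum fun y _ => negMulLog_add_le ha hb hab (outputDist_nonneg hP hQ0 y)
      (outputDist_nonneg hP hQ0' y)
  rw [h2, smul_eq_mul, smul_eq_mul]
  have e1 := mul_le_mul_of_nonneg_left hE (sub_nonneg.2 hr1)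
  have e2 := mul_le_mul_of_nonneg_left h3 hr0
  have e3 : r * R = a * (r * R) + b * (r * R) := by rw [← add_mul, hab, one_mul]
  nlinarith

omit [Fintype X] in
theorem self_mem_dominatedChannels (P : X → ℝ) {W : X → Y → ℝ} (hW : IsChannel W) :
    W ∈ dominatedChannels P W := ⟨hW, fun _ _ _ h => h⟩

theorem exists_primal_minimizer (R : ℝ) {P : X → ℝ} (hP : ∀ x, 0 ≤ P x) {W : X → Y → ℝ}
    (hW : IsChannel W) :
    ∃ Q ∈ dominatedChannels P W, ∃ r ∈ Set.Icc (0 : ℝ) (1 / 2),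
      (∀ Q' ∈ dominatedChannels P W, condDiv P Q W + 1 / 2 * max 0 (R - mutInf P Q)
        ≤ condDiv P Q' W + 1 / 2 * max 0 (R - mutInf P Q')) ∧
      ∀ Q' ∈ dominatedChannels P W, condDiv P Q W + 1 / 2 * max 0 (R - mutInf P Q)
        ≤ lagrangian R P W r Q' := by
  obtain ⟨Q, hQ, t, ht, h1, h2⟩ := exists_minimax_pair (isCompact_dominatedChannels P W)
    ⟨W, self_mem_dominatedChannels P hW⟩
    (convexOn_lagrangian (R := R) hP le_rfl zero_le_one)
    (convexOn_lagrangian (R := R) hP (by norm_num : (0 : ℝ) ≤ 1 / 2) (by norm_num))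
    (continuousOn_lagrangian hP 0) (continuousOn_lagrangian hP (1 / 2))
  have hmax : ∀ Q, max (lagrangian R P W 0 Q) (lagrangian R P W (1 / 2) Q)
      = condDiv P Q W + 1 / 2 * max 0 (R - mutInf P Q) := fun Q => by
    rw [lagrangian, lagrangian, max_add_add_left, zero_mul, mul_max_of_nonneg _ _ (by norm_num),
      mul_zero]
  simp only [hmax] at h1 h2
  refine ⟨Q, hQ, t / 2, ⟨by linarith [ht.1], by linarith [ht.2]⟩, h1, fun Q' hQ' => ?_⟩
  refine (h2 Q' hQ').trans (le_of_eq ?_)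
  simp only [lagrangian]
  ring

/-- The output distribution of a minimizer of the Lagrangian charges the support of `W`. -/
theorem dominated_outputDist_of_isMin {R : ℝ} {P : X → ℝ} (hP : ∀ x, 0 ≤ P x) {W : X → Y → ℝ}
    (hW : IsChannel W) {r : ℝ} (hr0 : 0 < r) (hr1 : r ≤ 1) {Q : X → Y → ℝ}
    (hQ : Q ∈ dominatedChannels P W)
    (hmin : ∀ Q' ∈ dominatedChannels P W, lagrangian R P W r Q ≤ lagrangian R P W r Q') :
    Dominated P W fun _ => outputDist P Q := by
  classical
  intro x₀ y₀ hx₀ hy₀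
  by_contra hWne
  beta_reduce at hy₀
  have hW0 : ∀ x y, 0 ≤ W x y := fun x => (hW x).1
  have hQ0 : ∀ x y, 0 ≤ Q x y := fun x => (hQ.1 x).1
  have hWK := self_mem_dominatedChannels P hW
  set w := outputDist P W y₀ with hw
  have hwpos : 0 < w := by
    refine lt_of_le_of_ne (outputDist_nonneg hP hW0 y₀) fun h => hWne ?_
    exact dominated_outputDist hP hW0 x₀ y₀ hx₀ h.symm
  -- Moving from Q towards W by t gives `y₀` the output mass t w, whose entropy contains -t w log t.
  -- As t → 0 this outweighs every term linear in t and contradicts minimality.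
  have key : ∀ t, 0 < t → t < 1 →
      lagrangian R P W r Q ≤ lagrangian R P W r W + r * w * Real.log t := by
    intro t ht0 ht1
    have hab : (1 - t) + t = 1 := by ring
    have ha : 0 ≤ 1 - t := by linarith
    have hKt := convex_dominatedChannels P W hQ hWK ha ht0.le hab
    have hm := hmin _ hKt
    have hE := condEnt_add_le hP hQ0 hW0 ha ht0.le hab
    have h2 : ∑ x, ∑ y, P x * (((1 - t) • Q + t • W) x y * Real.log (W x y))
        = (1 - t) * ∑ x, ∑ y, P x * (Q x y * Real.log (W x y))
          + t * ∑ x, ∑ y, P x * (W x y * Real.log (W x y)) := by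
      simp only [Finset.mul_sum, ← Finset.sum_add_distrib, Pi.add_apply, Pi.smul_apply,
        smul_eq_mul]
      exact Finset.sum_congr rfl fun x _ => Finset.sum_congr rfl fun y _ => by ring
    have h3 : (1 - t) * ∑ y, Real.negMulLog (outputDist P Q y)
        + t * ∑ y, Real.negMulLog (outputDist P W y) - t * (w * Real.log t)
        ≤ ∑ y, Real.negMulLog (outputDist P ((1 - t) • Q + t • W) y) := by
      have hsingle : t * (w * Real.log t)
          = ∑ y, if y = y₀ then t * (w * Real.log t) else 0 := by simp
      rw [hsingle]
      simp only [Finset.mul_sum, ← Finset.sum_add_distrib, ← Finset.sum_sub_distrib,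
        outputDist_add]
      refine Finset.sum_le_sum fun y _ => ?_
      split_ifs with hy
      · subst hy
        rw [hy₀, ← hw, Real.negMulLog_zero, mul_zero, zero_add, zero_add,
          Real.negMulLog, Real.negMulLog, Real.log_mul ht0.ne' hwpos.ne']
        exact le_of_eq (by ring)
      · rw [sub_zero]
        exact negMulLog_add_le ha ht0.le hab (outputDist_nonneg hP hQ0 y)
          (outputDist_nonneg hP hW0 y)
    rw [lagrangian_eq hP r hKt, h2] at hm
    have eQ := lagrangian_eq (R := R) hP r hQ
    have eW := lagrangian_eq (R := R) hP r hWK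
    have e1 := mul_le_mul_of_nonneg_left hE (sub_nonneg.2 hr1)
    have e2 := mul_le_mul_of_nonneg_left h3 hr0.le
    have hfin : t * lagrangian R P W r Q
        ≤ t * (lagrangian R P W r W + r * w * Real.log t) := by
      have : lagrangian R P W r Q ≤ (1 - t) * lagrangian R P W r Q
          + t * lagrangian R P W r W + r * (t * (w * Real.log t)) := by
        refine hm.trans ?_
        rw [eQ, eW]
        linarith
      linarith
    exact le_of_mul_le_mul_left hfin ht0
  set N := (|lagrangian R P W r W - lagrangian R P W r Q| + 1) / (r * w) with hN
  have hNpos : 0 < N := by positivity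
  have h := key (Real.exp (-N)) (Real.exp_pos _) (Real.exp_lt_one_iff.2 (by linarith))
  rw [Real.log_exp, mul_neg, hN, mul_div_cancel₀ _ (by positivity)] at h
  linarith [le_abs_self (lagrangian R P W r W - lagrangian R P W r Q)]

/-- The normalizing constant of the channel proportional to `W ^ l * S ^ (1 - l)`. -/
def tiltSum (l : ℝ) (W : X → Y → ℝ) (S : Y → ℝ) (x : X) : ℝ := ∑ y, W x y ^ l * S y ^ (1 - l)

omit [Fintype X] in
theorem tiltSum_pos {P : X → ℝ} {W : X → Y → ℝ} (hW : IsChannel W) {S : Y → ℝ}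
    (hS : ∀ y, 0 ≤ S y) (hWS : Dominated P W fun _ => S) (l : ℝ) {x : X} (hx : P x ≠ 0) :
    0 < tiltSum l W S x := by
  obtain ⟨y, hy⟩ : ∃ y, W x y ≠ 0 := by
    by_contra hcon
    push Not at hcon
    have := (hW x).2
    simp [hcon] at this
  have hWy : 0 < W x y := lt_of_le_of_ne ((hW x).1 y) hy.symm
  have hSy : 0 < S y := lt_of_le_of_ne (hS y) fun h => hy (hWS x y hx h.symm)
  refine Finset.sum_pos' (fun y _ => ?_) ⟨y, Finset.mem_univ y, by positivity⟩
  exact mul_nonneg (Real.rpow_nonneg ((hW x).1 y) _) (Real.rpow_nonneg (hS y) _)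

/-- Duality for the Lagrangian at one of its minimizers. -/
theorem lagrangian_le_of_isMin {R : ℝ} {P : X → ℝ} (hP : ∀ x, 0 ≤ P x) (hP1 : ∑ x, P x = 1)
    {W : X → Y → ℝ}
    (hW : IsChannel W) {r : ℝ} (hr0 : 0 < r) (hr1 : r < 1) {Q : X → Y → ℝ}
    (hQ : Q ∈ dominatedChannels P W)
    (hmin : ∀ Q' ∈ dominatedChannels P W, lagrangian R P W r Q ≤ lagrangian R P W r Q') :
    lagrangian R P W r Q ≤ r * R - (1 - r) *
      ∑ x, P x * Real.log (tiltSum (1 / (1 - r)) W (outputDist P Q) x) := by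
  classical
  have hWS := dominated_outputDist_of_isMin hP hW hr0 hr1.le hQ hmin
  have hW0 : ∀ x y, 0 ≤ W x y := fun x => (hW x).1
  have hQ0 : ∀ x y, 0 ≤ Q x y := fun x => (hQ.1 x).1
  have hr' : 0 < 1 - r := by linarith
  set l := 1 / (1 - r) with hl
  have hl0 : 0 < l := by positivity
  set S := outputDist P Q with hS
  have hS0 : ∀ y, 0 ≤ S y := outputDist_nonneg hP hQ0
  have hS1 : ∑ y, S y = 1 := sum_outputDist hP1 fun x => (hQ.1 x).2
  have hZ : ∀ x, P x ≠ 0 → 0 < tiltSum l W S x := fun x hx => tiltSum_pos hW hS0 hWS l hx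
  -- The minimizer of the Lagrangian once the output law is frozen at S. On inputs of probability
  -- zero W is used, only to keep T a channel.
  set T : X → Y → ℝ := fun x y =>
    if P x = 0 then W x y else W x y ^ l * S y ^ (1 - l) / tiltSum l W S x with hT
  have hTK : T ∈ dominatedChannels P W := by
    refine ⟨fun x => ?_, fun x y hx hy => ?_⟩
    · by_cases hx : P x = 0
      · simpa [hT, hx] using hW x
      · refine ⟨fun y => ?_, ?_⟩
        · simp only [hT, hx, if_false]
          exact div_nonneg (mul_nonneg (Real.rpow_nonneg (hW0 x y) _)
            (Real.rpow_nonneg (hS0 y) _)) (hZ x hx).le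
        · simp only [hT, hx, if_false, ← Finset.sum_div]
          exact div_self (hZ x hx).ne'
    · simp [hT, hx, hy, Real.zero_rpow hl0.ne']
  have hT0 : ∀ x y, 0 ≤ T x y := fun x => (hTK.1 x).1
  have hWT : Dominated P W T := by
    intro x y hx hy
    simp only [hT, hx, if_false] at hy
    rcases div_eq_zero_iff.1 hy with h | h
    · rcases mul_eq_zero.1 h with h | h
      · exact (Real.rpow_eq_zero (hW0 x y) hl0.ne').1 h
      · by_contra hne
        have hSy : 0 < S y := lt_of_le_of_ne (hS0 y) fun h => hne (hWS x y hx h.symm)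
        exact (Real.rpow_pos_of_pos hSy (1 - l)).ne' h
    · exact absurd h (hZ x hx).ne'
  have hdT : ∀ Q' ∈ dominatedChannels P W, Dominated P Q' T := fun Q' hQ' x y hx hy =>
    hQ'.2 x y hx (hWT x y hx hy)
  -- A Pythagorean form: a constant, plus the divergence from T, plus that of the output law from S.
  -- The last term vanishes at Q.
  have hid : ∀ Q' ∈ dominatedChannels P W, lagrangian R P W r Q'
      = r * R - (1 - r) * ∑ x, P x * Real.log (tiltSum l W S x) + (1 - r) * condDiv P Q' T
        + r * ∑ y, outputDist P Q' y * Real.log (outputDist P Q' y / S y) := by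
    intro Q' hQ'
    have hZsum : ∑ x, P x * Real.log (tiltSum l W S x)
        = ∑ x, ∑ y, P x * (Q' x y * Real.log (tiltSum l W S x)) := by
      refine Finset.sum_congr rfl fun x _ => ?_
      rw [← Finset.mul_sum, ← Finset.sum_mul, (hQ'.1 x).2, one_mul]
    rw [hZsum, sum_mul_outputDist, lagrangian, mul_sub]
    suffices h : condDiv P Q' W - r * mutInf P Q'
        = -((1 - r) * ∑ x, ∑ y, P x * (Q' x y * Real.log (tiltSum l W S x)))
          + (1 - r) * condDiv P Q' T
          + r * ∑ x, ∑ y, P x * (Q' x y * Real.log (outputDist P Q' y / S y)) by linarith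
    simp only [condDiv, mutInf, Finset.mul_sum, ← Finset.sum_neg_distrib, ← Finset.sum_add_distrib,
      ← Finset.sum_sub_distrib]
    refine Finset.sum_congr rfl fun x _ => Finset.sum_congr rfl fun y _ => ?_
    by_cases hx : P x = 0
    · simp [hx]
    by_cases hy : Q' x y = 0
    · simp [hy]
    have hWy : 0 < W x y := lt_of_le_of_ne (hW0 x y) fun h => hy (hQ'.2 x y hx h.symm)
    have hSy : 0 < S y := lt_of_le_of_ne (hS0 y) fun h => hWy.ne' (hWS x y hx h.symm)
    have hoy : outputDist P Q' y ≠ 0 := fun h =>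
      hy (dominated_outputDist hP (fun x => (hQ'.1 x).1) x y hx h)
    have hlogT : Real.log (T x y)
        = l * Real.log (W x y) + (1 - l) * Real.log (S y) - Real.log (tiltSum l W S x) := by
      simp only [hT, hx, if_false]
      rw [Real.log_div (by positivity) (hZ x hx).ne', Real.log_mul (by positivity) (by positivity),
        Real.log_rpow hWy, Real.log_rpow hSy]
    have hTy : T x y ≠ 0 := fun h => hWy.ne' (hWT x y hx h)
    rw [Real.log_div hy hWy.ne', Real.log_div hy hoy, Real.log_div hy hTy,
      Real.log_div hoy hSy.ne', hlogT]
    have hlr : l * (1 - r) = 1 := by rw [hl]; field_simp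
    linear_combination (P x * Q' x y * (Real.log (W x y) - Real.log (S y))) * hlr
  have hQT := hid Q hQ
  have hSS : ∑ y, S y * Real.log (S y / S y) = 0 := by
    refine Finset.sum_eq_zero fun y _ => ?_
    by_cases hy : S y = 0
    · simp [hy]
    · simp [div_self hy]
  rw [← hS, hSS, mul_zero, add_zero] at hQT
  have hTT : condDiv P T T = 0 := by
    refine Finset.sum_eq_zero fun x _ => Finset.sum_eq_zero fun y _ => ?_
    by_cases hy : T x y = 0
    · simp [hy]
    · simp [div_self hy]
  set C := ∑ y, (outputDist P T y - S y) ^ 2 / S y with hC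
  -- Along the segment from Q to T, divergence from T drops at least linearly in t, while output
  -- divergence grows at most like t² times the chi-square quantity `C`. Minimality of Q therefore
  -- forces its divergence from T to be at most zero.
  have key : ∀ t, 0 < t → t ≤ 1 → (1 - r) * condDiv P Q T ≤ t * (r * C) := by
    intro t ht0 ht1
    have ha : 0 ≤ 1 - t := by linarith
    have hab : (1 - t) + t = 1 := by ring
    have hKt := convex_dominatedChannels P W hQ hTK ha ht0.le hab
    have hm := hmin _ hKt
    rw [hid _ hKt, hQT] at hm
    have h1 := condDiv_add_le hP hQ0 hT0 (hdT Q hQ) (hdT T hTK) ha ht0.le hab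
    rw [hTT, mul_zero, add_zero] at h1
    have hKl : ∑ y, outputDist P ((1 - t) • Q + t • T) y
        * Real.log (outputDist P ((1 - t) • Q + t • T) y / S y) ≤ t ^ 2 * C := by
      have hsum : t ^ 2 * C = ∑ y, (t * (outputDist P T y - S y)
          + t ^ 2 * ((outputDist P T y - S y) ^ 2 / S y)) := by
        rw [Finset.sum_add_distrib, ← Finset.mul_sum, ← Finset.mul_sum, Finset.sum_sub_distrib,
          sum_outputDist hP1 (fun x => (hTK.1 x).2), hS1, sub_self, mul_zero, zero_add]
      rw [hsum]
      refine Finset.sum_le_sum fun y _ => ?_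
      have hTS : S y = 0 → outputDist P T y = 0 := fun hy => by
        refine Finset.sum_eq_zero fun x _ => ?_
        by_cases hx : P x = 0
        · simp [hx]
        · rw [hTK.2 x y hx (hWS x y hx hy), mul_zero]
      rw [outputDist_add, ← hS]
      rcases (hS0 y).eq_or_lt with hy | hy
      · simp [hTS hy.symm, ← hy]
      · have ho := outputDist_nonneg hP hT0 y
        set o := outputDist P T y
        set z := (1 - t) * S y + t * o with hz
        have hz0 : 0 ≤ z := by positivity
        have e : t * (o - S y) + t ^ 2 * ((o - S y) ^ 2 / S y) = z * (z / S y - 1) := by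
          rw [hz]; field_simp; ring
        rw [e]
        rcases hz0.eq_or_lt with h | h
        · simp [← h]
        · exact mul_le_mul_of_nonneg_left (Real.log_le_sub_one_of_pos (by positivity)) hz0
    have e1 := mul_le_mul_of_nonneg_left h1 hr'.le
    have e2 := mul_le_mul_of_nonneg_left hKl hr0.le
    have hfin : t * ((1 - r) * condDiv P Q T) ≤ t * (t * (r * C)) := by nlinarith
    exact le_of_mul_le_mul_left hfin ht0
  have hle : (1 - r) * condDiv P Q T ≤ 0 := by
    by_contra hpos
    push Not at hpos
    set a := (1 - r) * condDiv P Q T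
    set b := r * C
    have hb : a ≤ b := by simpa using key 1 one_pos le_rfl
    have hb0 : 0 < b := hpos.trans_le hb
    have h := key (a / (2 * b)) (by positivity) (by rw [div_le_one (by positivity)]; linarith)
    have : a / (2 * b) * b = a / 2 := by field_simp
    linarith
  linarith

end

/-! ### Upper bound on the expected distance. -/

variable {X Y : Type*} [Fintype X] [Fintype Y]

theorem expectedTV_eq_sum (P : X → ℝ) (W : X → Y → ℝ) (n M : ℕ) :
    expectedTV P W n M = ∑ y, codebookExp (ccDist n P) M fun c =>
      |1 / (M : ℝ) * ∑ j, channelPow W n (c j) y - ∑ x, ccDist n P x * channelPow W n x y| := by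
  simp only [expectedTV, codebookExp, l1Dist, Finset.mul_sum, inducedDist, outputDist]
  exact Finset.sum_comm

/-- Jensen's inequality in the form used to change the order of the norms. -/
theorem sum_rpow_le_rpow_sum {η : Type*} [Fintype η] {S a : η → ℝ} (hS : S ∈ stdSimplex ℝ η)
    (ha : ∀ y, 0 ≤ a y) (hSa : ∀ y, S y = 0 → a y = 0) {l : ℝ} (hl : 1 ≤ l) :
    ∑ y, a y ^ (1 / l) ≤ (∑ y, S y ^ (1 - l) * a y) ^ (1 / l) := by
  have hl0 : 0 < l := by linarith
  have h := Real.rpow_arith_mean_le_arith_mean_rpow Finset.univ S (fun y => a y ^ (1 / l) / S y)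
    (fun y _ => hS.1 y) hS.2 (fun y _ => div_nonneg (Real.rpow_nonneg (ha y) _) (hS.1 y)) hl
  have e1 : ∀ y, S y * (a y ^ (1 / l) / S y) = a y ^ (1 / l) := fun y => by
    by_cases hy : S y = 0
    · rw [hy, hSa y hy, Real.zero_rpow (by positivity), zero_mul]
    · field_simp
  have e2 : ∀ y, S y * (a y ^ (1 / l) / S y) ^ l = S y ^ (1 - l) * a y := fun y => by
    rcases (hS.1 y).eq_or_lt with hy | hy
    · rw [hSa y hy.symm, ← hy]; simp
    · rw [Real.div_rpow (Real.rpow_nonneg (ha y) _) hy.le, ← Real.rpow_mul (ha y),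
        one_div_mul_cancel hl0.ne', Real.rpow_one, Real.rpow_sub hy, Real.rpow_one]
      field_simp
  simp only [e1, e2] at h
  have h0 : 0 ≤ ∑ y, a y ^ (1 / l) := Finset.sum_nonneg fun y _ => Real.rpow_nonneg (ha y) _
  calc ∑ y, a y ^ (1 / l) = ((∑ y, a y ^ (1 / l)) ^ l) ^ (1 / l) := by
        rw [← Real.rpow_mul h0, mul_one_div_cancel hl0.ne', Real.rpow_one]
    _ ≤ _ := Real.rpow_le_rpow (Real.rpow_nonneg h0 _) h (by positivity)

omit [Fintype X] [Fintype Y] in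
theorem channelPow_nonneg {W : X → Y → ℝ} (hW : ∀ x y, 0 ≤ W x y) (n : ℕ) (x : Fin n → X)
    (y : Fin n → Y) : 0 ≤ channelPow W n x y := Finset.prod_nonneg fun _ _ => hW _ _

omit [Fintype X] in
theorem isChannel_channelPow {W : X → Y → ℝ} (hW : IsChannel W) (n : ℕ) :
    IsChannel (channelPow W n) := fun x =>
  ⟨channelPow_nonneg (fun x => (hW x).1) n x,
    sum_pi_eq_one (fun i b => W (x i) b) fun i => (hW (x i)).2⟩

/-- Upper bound on the expected total variation distance, for every order and every auxiliary
output distribution. -/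
theorem expectedTV_le {P : X → ℝ} {W : X → Y → ℝ} (hW : IsChannel W) {S : Y → ℝ}
    (hS : S ∈ stdSimplex ℝ Y) (hWS : Dominated P W fun _ => S) {l : ℝ}
    (hl : l ∈ Set.Icc (1 : ℝ) 2) {n M : ℕ} (hn : 0 < n) (hM : 0 < M)
    (hT : (typeClass n P).Nonempty) :
    expectedTV P W n M ≤ 3 * ((M : ℝ) ^ (1 - l) *
      Real.exp (n * ∑ x, P x * Real.log (tiltSum l W S x))) ^ (1 / l) := by
  have hl0 : 0 < l := by linarith [hl.1]
  have hW0 : ∀ x y, 0 ≤ W x y := fun x => (hW x).1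
  have hV0 := channelPow_nonneg hW0 n
  set u := ccDist n P with hu
  have hu0 : ∀ x, 0 ≤ u x := ccDist_nonneg n P
  have hu1 : ∑ x, u x = 1 := sum_ccDist hT
  set a : (Fin n → Y) → ℝ := fun y => ∑ x, u x * channelPow W n x y ^ l with ha
  have ha0 : ∀ y, 0 ≤ a y := fun y =>
    Finset.sum_nonneg fun x _ => mul_nonneg (hu0 x) (Real.rpow_nonneg (hV0 x y) _)
  set Sn : (Fin n → Y) → ℝ := fun y => ∏ i, S (y i) with hSn
  have hSns : Sn ∈ stdSimplex ℝ (Fin n → Y) :=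
    ⟨fun y => Finset.prod_nonneg fun i _ => hS.1 _, sum_pi_eq_one (fun _ => S) fun _ => hS.2⟩
  have hSa : ∀ y, Sn y = 0 → a y = 0 := by
    intro y hy
    obtain ⟨i, _, hi⟩ := Finset.prod_eq_zero_iff.1 hy
    refine Finset.sum_eq_zero fun x _ => ?_
    by_cases hx : x ∈ typeClass n P
    · have : channelPow W n x y = 0 := Finset.prod_eq_zero (Finset.mem_univ i)
        (hWS _ _ (apply_ne_zero_of_mem_typeClass hx i) hi)
      rw [this, Real.zero_rpow hl0.ne', mul_zero]
    · simp [hu, ccDist, hx]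
  -- The sum over `y` is a product of letterwise sums that depends on `x` only through its type, so
  -- it is constant on the type class.
  have hsum : ∑ y, Sn y ^ (1 - l) * a y
      ≤ Real.exp (n * ∑ x, P x * Real.log (tiltSum l W S x)) := by
    have e : ∑ y, Sn y ^ (1 - l) * a y
        = ∑ x, u x * ∏ i, tiltSum l W S (x i) := by
      simp only [ha, Finset.mul_sum]
      rw [Finset.sum_comm]
      refine Finset.sum_congr rfl fun x _ => ?_
      simp only [tiltSum]
      rw [← sum_pi_prod fun i b => W (x i) b ^ l * S b ^ (1 - l), Finset.mul_sum]
      refine Finset.sum_congr rfl fun y _ => ?_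
      rw [Finset.prod_mul_distrib, Real.finsetProd_rpow _ _ fun i _ => hW0 _ _,
        Real.finsetProd_rpow _ _ fun i _ => hS.1 _]
      simp only [hSn, channelPow]
      ring
    rw [e]
    refine sum_ccDist_mul_le hT _ _ fun x hx => le_of_eq ?_
    rw [← sum_apply_of_mem_typeClass hn hx fun b => Real.log (tiltSum l W S b), Real.exp_sum]
    exact Finset.prod_congr rfl fun i _ =>
      (Real.exp_log (tiltSum_pos hW hS.1 hWS l (apply_ne_zero_of_mem_typeClass hx i))).symm
  have hMl : 0 ≤ (M : ℝ) ^ (1 - l) := by positivity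
  rw [expectedTV_eq_sum]
  calc _ ≤ ∑ y, 3 * ((M : ℝ) ^ (1 - l) * a y) ^ (1 / l) := Finset.sum_le_sum fun y _ =>
        codebookExp_abs_mean_sub_le_rpow hu0 hu1 hM (v := fun x => channelPow W n x y)
          (fun x => hV0 x y) hl
    _ = 3 * (((M : ℝ) ^ (1 - l)) ^ (1 / l) * ∑ y, a y ^ (1 / l)) := by
        rw [Finset.mul_sum, Finset.mul_sum]
        exact Finset.sum_congr rfl fun y _ => by rw [Real.mul_rpow hMl (ha0 y)]
    _ ≤ 3 * (((M : ℝ) ^ (1 - l)) ^ (1 / l) *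
          Real.exp (n * ∑ x, P x * Real.log (tiltSum l W S x)) ^ (1 / l)) := by
        have h1 := sum_rpow_le_rpow_sum hSns ha0 hSa hl.1
        have h2 : (∑ y, Sn y ^ (1 - l) * a y) ^ (1 / l)
            ≤ Real.exp (n * ∑ x, P x * Real.log (tiltSum l W S x)) ^ (1 / l) :=
          Real.rpow_le_rpow (Finset.sum_nonneg fun y _ =>
            mul_nonneg (Real.rpow_nonneg (hSns.1 y) _) (ha0 y)) hsum (by positivity)
        have h3 := h1.trans h2
        gcongr
    _ = _ := by rw [Real.mul_rpow hMl (Real.exp_pos _).le]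

theorem expectedTV_le_exp {P : X → ℝ} {W : X → Y → ℝ} (hW : IsChannel W) {S : Y → ℝ}
    (hS : S ∈ stdSimplex ℝ Y) (hWS : Dominated P W fun _ => S) {l : ℝ}
    (hl : l ∈ Set.Icc (1 : ℝ) 2) {n M : ℕ} (hn : 0 < n) (hT : (typeClass n P).Nonempty) {R : ℝ}
    (hM : Real.exp (n * R) ≤ M) :
    expectedTV P W n M ≤ 3 * Real.exp (-n * ((l - 1) / l * R
      - 1 / l * ∑ x, P x * Real.log (tiltSum l W S x))) := by
  have hl0 : 0 < l := by linarith [hl.1]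
  have hM0 : 0 < M := by
    have : (0 : ℝ) < M := (Real.exp_pos _).trans_le hM
    exact_mod_cast this
  refine (expectedTV_le hW hS hWS hl hn hM0 hT).trans ?_
  have h1 : (M : ℝ) ^ (1 - l) ≤ Real.exp (n * R) ^ (1 - l) :=
    Real.rpow_le_rpow_of_nonpos (Real.exp_pos _) hM (by linarith [hl.1])
  have h2 : Real.exp (-n * ((l - 1) / l * R - 1 / l * ∑ x, P x * Real.log (tiltSum l W S x)))
      = (Real.exp (n * R) ^ (1 - l) *
        Real.exp (n * ∑ x, P x * Real.log (tiltSum l W S x))) ^ (1 / l) := by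
    rw [← Real.exp_mul, ← Real.exp_add, ← Real.exp_mul]
    congr 1
    field_simp
    ring
  rw [h2]
  gcongr

/-! ### Lower bound on the expected distance through a test channel. -/

/-- Weak law of large numbers for the channel output of an input of type `P`. -/
theorem sum_channelPow_le_of_typeClass {P : X → ℝ} {Q : X → Y → ℝ} (hQ : IsChannel Q)
    (ψ : X → Y → ℝ) {n : ℕ} (hn : 0 < n) {e : ℝ} (he : 0 < e) {x : Fin n → X}
    (hx : x ∈ typeClass n P) (s : Finset (Fin n → Y))
    (hs : ∀ y ∈ s, ∑ i, ψ (x i) (y i) ≤ n * (∑ a, ∑ b, P a * (Q a b * ψ a b) - e)) :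
    ∑ y ∈ s, channelPow Q n x y ≤ (∑ a, ∑ b, Q a b * ψ a b ^ 2) / e ^ 2 / n := by
  have hnr : (0 : ℝ) < n := by positivity
  have hmean : ∑ i, ∑ b, Q (x i) b * ψ (x i) b = n * ∑ a, ∑ b, P a * (Q a b * ψ a b) := by
    rw [sum_apply_of_mem_typeClass hn hx fun a => ∑ b, Q a b * ψ a b]
    simp only [Finset.mul_sum]
  -- Summing second moments over all input letters bounds them uniformly over positions.
  have h := chebyshev_pi (fun i b => Q (x i) b) (fun i b => (hQ _).1 b) (fun i => (hQ _).2)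
    (fun i b => ψ (x i) b) (B := ∑ a, ∑ b, Q a b * ψ a b ^ 2) (t := n * e)
    (fun i => Finset.single_le_sum (f := fun a => ∑ b, Q a b * ψ a b ^ 2)
      (fun a _ => Finset.sum_nonneg fun b _ => mul_nonneg ((hQ a).1 b) (sq_nonneg _))
      (Finset.mem_univ (x i))) (by positivity) s (fun y hy => by
        rw [hmean]; linarith [hs y hy])
  refine h.trans (le_of_eq ?_)
  rw [Fintype.card_fin]
  field_simp

omit [Fintype Y] in
-- A product input through a memoryless channel has a product output, so domination of the input
-- laws passes to the outputs.
theorem outputDist_ccDist_channelPow_le {P : X → ℝ} {Q : X → Y → ℝ} (hQ0 : ∀ x y, 0 ≤ Q x y)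
    {n : ℕ} {c : ℝ} (hc : ∀ x, ccDist n P x ≤ c * ∏ i, P (x i)) (y : Fin n → Y) :
    outputDist (ccDist n P) (channelPow Q n) y ≤ c * ∏ i, outputDist P Q (y i) := by
  have h : ∏ i, outputDist P Q (y i) = ∑ x : Fin n → X, ∏ i, (P (x i) * Q (x i) (y i)) :=
    (sum_pi_prod fun i a => P a * Q a (y i)).symm
  rw [h, Finset.mul_sum]
  refine Finset.sum_le_sum fun x _ => ?_
  rw [Finset.prod_mul_distrib, ← mul_assoc]
  exact mul_le_mul_of_nonneg_right (hc x) (channelPow_nonneg hQ0 n x y)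

omit [Fintype X] [Fintype Y] in
theorem channelPow_eq_exp {Q V : X → Y → ℝ} (hQ : ∀ x y, 0 ≤ Q x y) (hV : ∀ x y, 0 ≤ V x y)
    {n : ℕ} {x : Fin n → X} {y : Fin n → Y} (hq : ∀ i, Q (x i) (y i) ≠ 0)
    (hv : ∀ i, V (x i) (y i) ≠ 0) :
    channelPow Q n x y
      = channelPow V n x y * Real.exp (∑ i, Real.log (Q (x i) (y i) / V (x i) (y i))) := by
  rw [Real.exp_sum, channelPow, channelPow, ← Finset.prod_mul_distrib]
  refine Finset.prod_congr rfl fun i _ => ?_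
  have h1 : 0 < Q (x i) (y i) := lt_of_le_of_ne (hQ _ _) (hq i).symm
  have h2 : 0 < V (x i) (y i) := lt_of_le_of_ne (hV _ _) (hv i).symm
  rw [Real.exp_log (div_pos h1 h2)]
  field_simp

/-- Input-output pairs that are typical for the test channel `Q`. -/
def IsTypicalPair (P : X → ℝ) (W Q : X → Y → ℝ) (e : ℝ) (n : ℕ) (x : Fin n → X)
    (y : Fin n → Y) : Prop :=
  channelPow Q n x y ≠ 0 ∧
  channelPow Q n x y * Real.exp (-n * (condDiv P Q W + e)) ≤ channelPow W n x y ∧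
  (∏ i, outputDist P Q (y i)) * Real.exp (n * (mutInf P Q - e)) ≤ channelPow Q n x y ∧
  outputDist (ccDist n P) (channelPow W n) y
    ≤ Real.exp (n * e) * outputDist (ccDist n P) (channelPow Q n) y

open scoped Classical in
/-- Under the test channel, typical pairs have probability at least one half. -/
theorem half_le_sum_typical {P : X → ℝ} (hP : ∀ x, 0 ≤ P x) {W : X → Y → ℝ} (hW : IsChannel W)
    {Q : X → Y → ℝ} (hQ : Q ∈ dominatedChannels P W) {n : ℕ} (hn : 0 < n) {e : ℝ} (he : 0 < e)
    (hT : (typeClass n P).Nonempty)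
    (h1 : (∑ a, ∑ b, Q a b * Real.log (W a b / Q a b) ^ 2) / e ^ 2 / n ≤ 1 / 8)
    (h2 : (∑ a, ∑ b, Q a b * Real.log (Q a b / outputDist P Q b) ^ 2) / e ^ 2 / n ≤ 1 / 8)
    (h3 : Real.exp (-n * e) ≤ 1 / 4) :
    1 / 2 ≤ ∑ x ∈ typeClass n P, ∑ y, ccDist n P x *
      if IsTypicalPair P W Q e n x y then channelPow Q n x y else 0 := by
  have hQ0 : ∀ x y, 0 ≤ Q x y := fun x => (hQ.1 x).1
  have hW0 : ∀ x y, 0 ≤ W x y := fun x => (hW x).1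
  have hS0 := outputDist_nonneg hP hQ0
  have hnr : (0 : ℝ) < n := by positivity
  set u := ccDist n P with hu
  have hu0 : ∀ x, 0 ≤ u x := ccDist_nonneg n P
  have hu1 : ∑ x ∈ typeClass n P, u x = 1 := by
    rw [← sum_ccDist hT]
    exact Finset.sum_subset (Finset.subset_univ _) fun x _ hx => by simp [hu, ccDist, hx]
  -- The three ways to be atypical. The weak law gives 1/8 for each of the first two, and a change
  -- of measure gives exp(-ne) ≤ 1/4 for the third, leaving one half.
  set B₁ : (Fin n → X) → Finset (Fin n → Y) := fun x => Finset.univ.filter fun y =>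
    channelPow Q n x y ≠ 0 ∧
      channelPow W n x y < channelPow Q n x y * Real.exp (-n * (condDiv P Q W + e)) with hB₁
  set B₂ : (Fin n → X) → Finset (Fin n → Y) := fun x => Finset.univ.filter fun y =>
    channelPow Q n x y ≠ 0 ∧ channelPow Q n x y
      < (∏ i, outputDist P Q (y i)) * Real.exp (n * (mutInf P Q - e)) with hB₂
  set B₃ : Finset (Fin n → Y) := Finset.univ.filter fun y =>
    Real.exp (n * e) * outputDist u (channelPow Q n) y < outputDist u (channelPow W n) y with hB₃
  have hpos : ∀ x y, channelPow Q n x y ≠ 0 → ∀ i, Q (x i) (y i) ≠ 0 := fun x y h i hi =>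
    h (Finset.prod_eq_zero (Finset.mem_univ i) hi)
  have b1 : ∀ x ∈ typeClass n P, ∑ y ∈ B₁ x, channelPow Q n x y ≤ 1 / 8 := by
    intro x hx
    refine (sum_channelPow_le_of_typeClass hQ.1 (fun a b => Real.log (W a b / Q a b)) hn he hx _
      fun y hy => ?_).trans h1
    obtain ⟨hy0, hy⟩ := (Finset.mem_filter.1 hy).2
    have hq := hpos x y hy0
    have hw : ∀ i, W (x i) (y i) ≠ 0 := fun i hi =>
      hq i (hQ.2 _ _ (apply_ne_zero_of_mem_typeClass hx i) hi)
    have hqp : 0 < channelPow Q n x y := lt_of_le_of_ne (channelPow_nonneg hQ0 n x y) hy0.symm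
    rw [channelPow_eq_exp hW0 hQ0 hw hq, mul_lt_mul_iff_right₀ hqp, Real.exp_lt_exp] at hy
    have hD : ∑ a, ∑ b, P a * (Q a b * Real.log (W a b / Q a b)) = -condDiv P Q W := by
      simp only [condDiv, ← Finset.sum_neg_distrib]
      refine Finset.sum_congr rfl fun a _ => Finset.sum_congr rfl fun b _ => ?_
      rw [← inv_div, Real.log_inv]
      ring
    rw [hD]
    linarith
  have b2 : ∀ x ∈ typeClass n P, ∑ y ∈ B₂ x, channelPow Q n x y ≤ 1 / 8 := by
    intro x hx
    refine (sum_channelPow_le_of_typeClass hQ.1 (fun a b => Real.log (Q a b / outputDist P Q b))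
      hn he hx _ fun y hy => ?_).trans h2
    obtain ⟨hy0, hy⟩ := (Finset.mem_filter.1 hy).2
    have hq := hpos x y hy0
    have hs : ∀ i, outputDist P Q (y i) ≠ 0 := fun i hi => hq i
      (dominated_outputDist hP hQ0 _ _ (apply_ne_zero_of_mem_typeClass hx i) hi)
    have hsp : 0 < ∏ i, outputDist P Q (y i) :=
      Finset.prod_pos fun i _ => lt_of_le_of_ne (hS0 _) (hs i).symm
    have e1 := channelPow_eq_exp hQ0 (V := fun _ => outputDist P Q) (fun _ => hS0) hq hs
    rw [e1, channelPow, mul_lt_mul_iff_right₀ hsp, Real.exp_lt_exp] at hy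
    exact hy.le
  have b3 : ∑ x ∈ typeClass n P, u x * ∑ y ∈ B₃, channelPow Q n x y ≤ 1 / 4 := by
    refine le_trans ?_ h3
    calc ∑ x ∈ typeClass n P, u x * ∑ y ∈ B₃, channelPow Q n x y
        ≤ ∑ x, u x * ∑ y ∈ B₃, channelPow Q n x y :=
          Finset.sum_le_sum_of_subset_of_nonneg (Finset.subset_univ _) fun x _ _ =>
            mul_nonneg (hu0 x) (Finset.sum_nonneg fun y _ => channelPow_nonneg hQ0 n x y)
      _ = ∑ y ∈ B₃, outputDist u (channelPow Q n) y := by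
          simp only [Finset.mul_sum, outputDist]
          exact Finset.sum_comm
      _ ≤ ∑ y ∈ B₃, Real.exp (-n * e) * outputDist u (channelPow W n) y := by
          refine Finset.sum_le_sum fun y hy => ?_
          rw [neg_mul, Real.exp_neg, inv_mul_eq_div, le_div_iff₀ (Real.exp_pos _), mul_comm]
          exact (Finset.mem_filter.1 hy).2.le
      _ ≤ ∑ y, Real.exp (-n * e) * outputDist u (channelPow W n) y :=
          Finset.sum_le_sum_of_subset_of_nonneg (Finset.subset_univ _) fun y _ _ =>
            mul_nonneg (Real.exp_pos _).le
              (outputDist_nonneg hu0 (channelPow_nonneg hW0 n) y)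
      _ = Real.exp (-n * e) := by
          rw [← Finset.mul_sum, sum_outputDist (sum_ccDist hT)
            fun x => (isChannel_channelPow hW n x).2, mul_one]
  have hcover : ∀ x y, channelPow Q n x y
      ≤ (if IsTypicalPair P W Q e n x y then channelPow Q n x y else 0)
        + (if y ∈ B₁ x then channelPow Q n x y else 0)
        + (if y ∈ B₂ x then channelPow Q n x y else 0)
        + (if y ∈ B₃ then channelPow Q n x y else 0) := by
    intro x y
    have h0 := channelPow_nonneg hQ0 n x y
    have hnn : ∀ (p : Prop) [Decidable p], 0 ≤ if p then channelPow Q n x y else 0 := fun p _ => by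
      split_ifs <;> simp [h0]
    have i0 := hnn (IsTypicalPair P W Q e n x y)
    have i1 := hnn (y ∈ B₁ x)
    have i2 := hnn (y ∈ B₂ x)
    have i3 := hnn (y ∈ B₃)
    by_cases c0 : channelPow Q n x y = 0
    · simp [c0]
    by_cases c1 : y ∈ B₁ x
    · rw [if_pos c1]; linarith
    by_cases c2 : y ∈ B₂ x
    · rw [if_pos c2]; linarith
    by_cases c3 : y ∈ B₃
    · rw [if_pos c3]; linarith
    have c4 : IsTypicalPair P W Q e n x y := by
      simp only [hB₁, hB₂, hB₃, Finset.mem_filter, Finset.mem_univ, true_and, not_and, not_lt]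
        at c1 c2 c3
      exact ⟨c0, c1 c0, c2 c0, c3⟩
    rw [if_pos c4]; linarith
  have htot : (1 : ℝ) ≤ ∑ x ∈ typeClass n P, (∑ y, u x *
      (if IsTypicalPair P W Q e n x y then channelPow Q n x y else 0)
        + u x * (1 / 8) + u x * (1 / 8) + u x * ∑ y ∈ B₃, channelPow Q n x y) := by
    rw [← hu1]
    refine Finset.sum_le_sum fun x hx => ?_
    have h := Finset.sum_le_sum fun y (_ : y ∈ Finset.univ) => hcover x y
    rw [(isChannel_channelPow hQ.1 n x).2] at h
    simp only [Finset.sum_add_distrib, Finset.sum_ite_mem, Finset.univ_inter] at h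
    rw [← Finset.mul_sum, ← mul_add, ← mul_add, ← mul_add]
    refine le_mul_of_one_le_right (hu0 x) ?_
    linarith [b1 x hx, b2 x hx]
  simp only [Finset.sum_add_distrib, ← Finset.sum_mul, hu1] at htot
  linarith

/-- One-shot form of the lower bound on the expected total variation distance. -/
theorem exp_le_expectedTV {P : X → ℝ} (hP : ∀ x, 0 ≤ P x) {W : X → Y → ℝ} (hW : IsChannel W)
    {Q : X → Y → ℝ} (hQ : Q ∈ dominatedChannels P W) {n M : ℕ} (hn : 0 < n) (hM : 0 < M)
    {R e : ℝ} (he : 0 < e)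
    (hT : (typeClass n P).Nonempty)
    (h1 : (∑ a, ∑ b, Q a b * Real.log (W a b / Q a b) ^ 2) / e ^ 2 / n ≤ 1 / 8)
    (h2 : (∑ a, ∑ b, Q a b * Real.log (Q a b / outputDist P Q b) ^ 2) / e ^ 2 / n ≤ 1 / 8)
    (h3 : Real.exp (-n * e) ≤ 1 / 16)
    (hc : ∀ x, ccDist n P x ≤ Real.exp (n * e) * ∏ i, P (x i))
    (hDI : condDiv P Q W + 5 * e ≤ mutInf P Q)
    (hMR : (M : ℝ) ≤ 2 * Real.exp (n * R)) :
    Real.exp (-n * (condDiv P Q W + 1 / 2 * max 0 (R - mutInf P Q) + 3 * e))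
      ≤ expectedTV P W n M := by
  classical
  have hQ0 : ∀ x y, 0 ≤ Q x y := fun x => (hQ.1 x).1
  have hW0 : ∀ x y, 0 ≤ W x y := fun x => (hW x).1
  have hS0 := outputDist_nonneg hP hQ0
  have hnr : (0 : ℝ) < n := by positivity
  have hMp : (0 : ℝ) < M := by positivity
  have hmass := half_le_sum_typical hP hW hQ hn he hT h1 h2 (h3.trans (by norm_num))
  have hqbar := outputDist_ccDist_channelPow_le hQ0 hc
  set D := condDiv P Q W with hD
  set I := mutInf P Q with hI
  set u := ccDist n P with hu
  have hu0 : ∀ x, 0 ≤ u x := ccDist_nonneg n P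
  have hu1 : ∑ x, u x = 1 := sum_ccDist hT
  set A : (Fin n → Y) → Finset (Fin n → X) := fun y =>
    (typeClass n P).filter fun x => IsTypicalPair P W Q e n x y with hA
  -- Typical inputs for a given `y` have total probability at most exp(-n(I - 2e)), so this `s`
  -- meets the condition M·P(A)·s ≤ 1 of the test-function bound.
  set s : ℝ := min 1 (Real.exp (n * (I - 2 * e)) / M) with hs
  have hs0 : 0 < s := lt_min one_pos (by positivity)
  have hp : ∀ y, (M : ℝ) * (∑ x ∈ A y, u x) * s ≤ 1 := by
    intro y
    have hp0 : 0 ≤ ∑ x ∈ A y, u x := Finset.sum_nonneg fun x _ => hu0 x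
    rcases (A y).eq_empty_or_nonempty with hA0 | ⟨x₀, hx₀⟩
    · simp [hA0]
    obtain ⟨hx₀T, hx₀A⟩ := Finset.mem_filter.1 hx₀
    have hsp : 0 < ∏ i, outputDist P Q (y i) := Finset.prod_pos fun i _ =>
      lt_of_le_of_ne (hS0 _) fun h => hx₀A.1 (Finset.prod_eq_zero (Finset.mem_univ i)
        (dominated_outputDist hP hQ0 _ _ (apply_ne_zero_of_mem_typeClass hx₀T i) h.symm))
    have hlow : (∑ x ∈ A y, u x) * ((∏ i, outputDist P Q (y i)) * Real.exp (n * (I - e)))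
        ≤ Real.exp (n * e) * ∏ i, outputDist P Q (y i) := by
      refine le_trans ?_ (hqbar y)
      rw [Finset.sum_mul, outputDist]
      refine (Finset.sum_le_sum fun x hx => mul_le_mul_of_nonneg_left
        (Finset.mem_filter.1 hx).2.2.2.1 (hu0 x)).trans ?_
      exact Finset.sum_le_sum_of_subset_of_nonneg (Finset.subset_univ _) fun x _ _ =>
        mul_nonneg (hu0 x) (channelPow_nonneg hQ0 n x y)
    have hpe : (∑ x ∈ A y, u x) * Real.exp (n * (I - 2 * e)) ≤ 1 := by
      have e1 : Real.exp (n * (I - e)) = Real.exp (n * (I - 2 * e)) * Real.exp (n * e) := by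
        rw [← Real.exp_add]; congr 1; ring
      rw [e1] at hlow
      refine le_of_mul_le_mul_right ?_ (mul_pos hsp (Real.exp_pos (n * e)))
      linarith
    calc (M : ℝ) * (∑ x ∈ A y, u x) * s
        ≤ (M : ℝ) * (∑ x ∈ A y, u x) * (Real.exp (n * (I - 2 * e)) / M) := by
          gcongr
          exact min_le_right _ _
      _ = (∑ x ∈ A y, u x) * Real.exp (n * (I - 2 * e)) := by field_simp
      _ ≤ 1 := hpe
  -- On typical pairs the mean output mass is at most exp(n(4e - (I - D))) times the codeword's own.
  -- The margin 5e in `hDI` makes this factor at most exp(-ne), so centring costs at most a half.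
  have hhalf : ∀ y, ∀ x ∈ A y,
      outputDist u (channelPow W n) y ≤ 1 / 2 * channelPow W n x y := by
    intro y x hx
    obtain ⟨hxT, -, t1, t2, t3⟩ := Finset.mem_filter.1 hx
    set q := channelPow Q n x y
    set Sy := ∏ i, outputDist P Q (y i)
    have hexp : Real.exp (n * (5 * e - (I - D)) - n * e) ≤ 1 / 16 := by
      refine le_trans (Real.exp_le_exp.2 ?_) h3
      nlinarith
    have c1 : outputDist u (channelPow W n) y ≤ Real.exp (n * e) * (Real.exp (n * e) * Sy) :=
      t3.trans (mul_le_mul_of_nonneg_left (hqbar y) (Real.exp_pos _).le)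
    have c2 : Sy ≤ Real.exp (-n * (I - e)) * q := by
      rw [neg_mul, Real.exp_neg, inv_mul_eq_div, le_div_iff₀ (Real.exp_pos _)]
      exact t2
    have c3 : q ≤ Real.exp (n * (D + e)) * channelPow W n x y := by
      rw [neg_mul, Real.exp_neg, ← div_eq_mul_inv, div_le_iff₀ (Real.exp_pos _)] at t1
      linarith
    calc outputDist u (channelPow W n) y
        ≤ Real.exp (n * e) * (Real.exp (n * e) * (Real.exp (-n * (I - e)) *
          (Real.exp (n * (D + e)) * channelPow W n x y))) := by
          refine c1.trans ?_
          gcongr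
          refine c2.trans ?_
          gcongr
      _ = Real.exp (n * (5 * e - (I - D)) - n * e) * channelPow W n x y := by
          rw [← mul_assoc, ← mul_assoc, ← mul_assoc, ← Real.exp_add, ← Real.exp_add,
            ← Real.exp_add]
          congr 2
          ring
      _ ≤ 1 / 2 * channelPow W n x y :=
          mul_le_mul_of_nonneg_right (by linarith) (channelPow_nonneg hW0 n x y)
  -- The three halves come from the test-function bound, from centring, and from the mass of typical
  -- pairs.
  have hmain : 1 / 8 * √s * Real.exp (-n * (D + e)) ≤ expectedTV P W n M := by
    rw [expectedTV_eq_sum]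
    calc 1 / 8 * √s * Real.exp (-n * (D + e))
        = 1 / 4 * √s * (Real.exp (-n * (D + e)) * (1 / 2)) := by ring
      _ ≤ 1 / 4 * √s * (Real.exp (-n * (D + e)) * ∑ x ∈ typeClass n P, ∑ y, u x *
            if IsTypicalPair P W Q e n x y then channelPow Q n x y else 0) := by gcongr
      _ ≤ 1 / 4 * √s * ∑ x ∈ typeClass n P, ∑ y,
            if IsTypicalPair P W Q e n x y then u x * channelPow W n x y else 0 := by
          refine mul_le_mul_of_nonneg_left ?_ (by positivity)
          simp only [Finset.mul_sum]
          refine Finset.sum_le_sum fun x _ => Finset.sum_le_sum fun y _ => ?_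
          split_ifs with h
          · rw [mul_left_comm, mul_comm (Real.exp _)]
            exact mul_le_mul_of_nonneg_left h.2.1 (hu0 x)
          · simp
      _ = ∑ y, 1 / 2 * √s * ∑ x ∈ A y, u x * (1 / 2 * channelPow W n x y) := by
          rw [Finset.sum_comm, Finset.mul_sum]
          refine Finset.sum_congr rfl fun y _ => ?_
          rw [← Finset.sum_filter, Finset.mul_sum, Finset.mul_sum]
          exact Finset.sum_congr rfl fun x _ => by ring
      _ ≤ _ := by
          refine Finset.sum_le_sum fun y _ => ?_
          refine le_trans ?_ (le_codebookExp_abs_mean_sub hu0 hu1 hM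
            (fun x => channelPow W n x y) (A y) hs0.le (min_le_left _ _) (hp y))
          refine mul_le_mul_of_nonneg_left (Finset.sum_le_sum fun x hx =>
            mul_le_mul_of_nonneg_left ?_ (hu0 x)) (by positivity)
          have := hhalf y x hx
          simp only [outputDist] at this
          linarith
  -- The square root of `s` is the origin of ½[R - I]₊: the minimum with 1 gives the positive part,
  -- and the 1/2 in front absorbs the factor 2 in `hMR`.
  have hsq : 1 / 2 * Real.exp (-n * (1 / 2 * max 0 (R - I) + e)) ≤ √s := by
    refine Real.le_sqrt_of_sq_le ?_
    have hm0 := le_max_left 0 (R - I)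
    have hm1 := le_max_right 0 (R - I)
    have e1 : (1 / 2 * Real.exp (-n * (1 / 2 * max 0 (R - I) + e))) ^ 2
        = 1 / 4 * Real.exp (-n * (max 0 (R - I) + 2 * e)) := by
      rw [mul_pow, ← Real.exp_nat_mul,
        show ((2 : ℕ) : ℝ) * (-n * (1 / 2 * max 0 (R - I) + e)) = -n * (max 0 (R - I) + 2 * e) by
          push_cast; ring]
      norm_num
    rw [e1]
    refine le_min ?_ ?_
    · have : Real.exp (-n * (max 0 (R - I) + 2 * e)) ≤ 1 := by
        rw [Real.exp_le_one_iff]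
        nlinarith
      linarith
    · rw [le_div_iff₀ hMp]
      calc 1 / 4 * Real.exp (-n * (max 0 (R - I) + 2 * e)) * M
          ≤ 1 / 4 * Real.exp (-n * (max 0 (R - I) + 2 * e)) * (2 * Real.exp (n * R)) := by
            gcongr
        _ = 1 / 2 * Real.exp (-n * (max 0 (R - I) + 2 * e) + n * R) := by
            rw [Real.exp_add]; ring
        _ ≤ 1 * Real.exp (n * (I - 2 * e)) := by
            gcongr
            · norm_num
            · nlinarith
        _ = _ := one_mul _
  calc Real.exp (-n * (D + 1 / 2 * max 0 (R - I) + 3 * e))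
      = Real.exp (-n * e) * Real.exp (-n * (1 / 2 * max 0 (R - I) + e))
          * Real.exp (-n * (D + e)) := by
        rw [← Real.exp_add, ← Real.exp_add]; congr 1; ring
    _ ≤ 1 / 16 * Real.exp (-n * (1 / 2 * max 0 (R - I) + e)) * Real.exp (-n * (D + e)) := by
        gcongr
    _ = 1 / 8 * (1 / 2 * Real.exp (-n * (1 / 2 * max 0 (R - I) + e)))
          * Real.exp (-n * (D + e)) := by ring
    _ ≤ 1 / 8 * √s * Real.exp (-n * (D + e)) := by gcongr
    _ ≤ _ := hmain

/-- The primal objective at a test channel with `D(Q ‖ W | P) < I(P, Q)` bounds the exponent of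
the expected total variation distance from above. -/
theorem eventually_exp_le_expectedTV {m : ℕ} (hm : 0 < m) {P : X → ℝ} (hP : IsType m P)
    {W : X → Y → ℝ} (hW : IsChannel W) {Q : X → Y → ℝ} (hQ : Q ∈ dominatedChannels P W)
    (hDI : condDiv P Q W < mutInf P Q) {R : ℝ} (hR : 0 ≤ R) {ε : ℝ} (hε : 0 < ε) :
    ∀ᶠ k : ℕ in atTop,
      Real.exp (-((m * k : ℕ) : ℝ) * (condDiv P Q W + 1 / 2 * max 0 (R - mutInf P Q) + ε))
        ≤ expectedTV P W (m * k) ⌈Real.exp (((m * k : ℕ) : ℝ) * R)⌉₊ := by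
  -- The total loss in the exponent is 3e, and the centring step needs D + 5e ≤ I.
  set e := min (ε / 3) ((mutInf P Q - condDiv P Q W) / 5) with he
  have he0 : 0 < e := lt_min (by positivity) (by linarith)
  have hmk : Tendsto (fun k : ℕ => m * k) atTop atTop := tendsto_id.const_mul_atTop' hm
  have hinv : ∀ B : ℝ, ∀ᶠ n : ℕ in atTop, B / (n : ℝ) ≤ 1 / 8 := fun B =>
    ((tendsto_const_div_atTop_nhds_zero_nat B).eventually (gt_mem_nhds (by norm_num))).mono
      fun _ h => h.le
  have hexp : ∀ᶠ n : ℕ in atTop, Real.exp (-(n : ℝ) * e) ≤ 1 / 16 := by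
    have h := eventually_const_mul_pow_le_exp 16 1 he0
    filter_upwards [h] with n hn
    rw [neg_mul, Real.exp_neg, one_div]
    refine inv_anti₀ (by norm_num) (le_trans ?_ hn)
    have : (0 : ℝ) ≤ n := by positivity
    rw [pow_one]
    linarith
  have hpoly := eventually_const_mul_pow_le_exp (Real.exp 1) (Fintype.card X) he0
  filter_upwards [hmk.eventually (hinv ((∑ a, ∑ b, Q a b * Real.log (W a b / Q a b) ^ 2) / e ^ 2)),
    hmk.eventually
      (hinv ((∑ a, ∑ b, Q a b * Real.log (Q a b / outputDist P Q b) ^ 2) / e ^ 2)),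
    hmk.eventually hexp, hmk.eventually hpoly, eventually_gt_atTop 0] with k h1 h2 h3 h4 hk
  have hn : 0 < m * k := by positivity
  have hT := typeClass_nonempty hm hk hP
  obtain ⟨N, hN, hNs⟩ := hP.exists_counts hm k
  set n := m * k with hndef
  have hnr : (0 : ℝ) < n := by positivity
  have hone : 1 ≤ Real.exp (n * R) := Real.one_le_exp (by positivity)
  have hM2 : ((⌈Real.exp ((n : ℝ) * R)⌉₊ : ℕ) : ℝ) ≤ 2 * Real.exp (n * R) := by
    linarith [(Nat.ceil_lt_add_one (Real.exp_pos ((n : ℝ) * R)).le).le]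
  refine le_trans (Real.exp_le_exp.2 ?_) (exp_le_expectedTV hP.1.1 hW hQ hn
    (Nat.ceil_pos.2 (Real.exp_pos _)) he0 hT h1 h2 h3 (fun x => ?_) ?_ hM2)
  · have : 3 * e ≤ ε := by linarith [min_le_left (ε / 3) ((mutInf P Q - condDiv P Q W) / 5)]
    nlinarith
  · refine (ccDist_le_prod hn hP.1.1 hN hNs hT x).trans ?_
    exact mul_le_mul_of_nonneg_right h4 (Finset.prod_nonneg fun i _ => hP.1.1 _)
  · linarith [min_le_right (ε / 3) ((mutInf P Q - condDiv P Q W) / 5)]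

/-! ### Translation between extended-real and real objectives. -/

theorem ereal_coe_sum {ι : Type*} (s : Finset ι) (f : ι → ℝ) :
    ((∑ i ∈ s, f i : ℝ) : EReal) = ∑ i ∈ s, (f i : EReal) := by
  classical
  induction s using Finset.induction_on with
  | empty => simp
  | insert a s ha ih => rw [Finset.sum_insert ha, Finset.sum_insert ha, EReal.coe_add, ih]

theorem ereal_sum_ne_bot {ι : Type*} (s : Finset ι) {f : ι → EReal} (h : ∀ i, f i ≠ ⊥) :
    ∑ i ∈ s, f i ≠ ⊥ := by
  classical
  induction s using Finset.induction_on with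
  | empty => simp
  | insert a s ha ih =>
    rw [Finset.sum_insert ha]
    simp [EReal.add_eq_bot_iff, h a, ih]

omit [Fintype X] [Fintype Y] in
theorem absCont_jointDist_iff (P : X → ℝ) (Q W : X → Y → ℝ) :
    AbsCont (jointDist P Q) (jointDist P W) ↔ Dominated P Q W := by
  simp only [AbsCont, jointDist, Dominated, Prod.forall, mul_eq_zero]
  refine forall_congr' fun x => forall_congr' fun y => ?_
  tauto

theorem relEntropy_jointDist_of_dominated {P : X → ℝ} {Q W : X → Y → ℝ} (h : Dominated P Q W) :
    relEntropy (jointDist P Q) (jointDist P W) = (condDiv P Q W : EReal) := by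
  rw [relEntropy, if_pos ((absCont_jointDist_iff P Q W).2 h), EReal.coe_eq_coe_iff,
    Fintype.sum_prod_type]
  refine Finset.sum_congr rfl fun x _ => Finset.sum_congr rfl fun y _ => ?_
  simp only [jointDist]
  by_cases hx : P x = 0
  · simp [hx]
  · rw [mul_div_mul_left _ _ hx, mul_assoc]

theorem mutualInfo_eq {P : X → ℝ} (hP : ∀ x, 0 ≤ P x) {Q : X → Y → ℝ} (hQ : ∀ x y, 0 ≤ Q x y) :
    relEntropy (jointDist P Q) (prodDist P (outputDist P Q)) = (mutInf P Q : EReal) :=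
  relEntropy_jointDist_of_dominated (W := fun _ => outputDist P Q) (dominated_outputDist hP hQ)

theorem primalObjective_of_dominated {R : ℝ} {P : X → ℝ} (hP : ∀ x, 0 ≤ P x) {W Q : X → Y → ℝ}
    (hQ : Q ∈ dominatedChannels P W) : primalObjective R P W Q
      = ((condDiv P Q W + 1 / 2 * max 0 (R - mutInf P Q) : ℝ) : EReal) := by
  rw [primalObjective, relEntropy_jointDist_of_dominated hQ.2,
    mutualInfo_eq hP fun x => (hQ.1 x).1, EReal.coe_add, EReal.coe_mul,
    EReal.coe_strictMono.monotone.map_max, EReal.coe_sub, EReal.coe_zero]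

theorem primalObjective_of_not_dominated {R : ℝ} {P : X → ℝ} {W Q : X → Y → ℝ}
    (hQ : ¬ Dominated P Q W) : primalObjective R P W Q = ⊤ := by
  rw [primalObjective, relEntropy, if_neg fun h => hQ ((absCont_jointDist_iff P Q W).1 h)]
  refine EReal.top_add_of_ne_bot (ne_of_gt (lt_of_lt_of_le EReal.bot_lt_zero ?_))
  exact mul_nonneg (by exact_mod_cast (by norm_num : (0 : ℝ) ≤ 1 / 2)) (le_max_left _ _)

theorem sum_renyiDiv_of_dominated {P : X → ℝ} {W : X → Y → ℝ} {S : Y → ℝ} {l : ℝ} (hl : 1 < l)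
    (h : Dominated P W fun _ => S) : ∑ a, (P a : EReal) * renyiDiv l (W a) S
      = ((1 / (l - 1) * ∑ x, P x * Real.log (tiltSum l W S x) : ℝ) : EReal) := by
  rw [Finset.mul_sum, ereal_coe_sum]
  refine Finset.sum_congr rfl fun a _ => ?_
  by_cases ha : P a = 0
  · simp [ha]
  · rw [renyiDiv, if_neg hl.ne', if_pos (show AbsCont (W a) S from fun y hy => h a y ha hy), ← EReal.coe_mul]
    congr 1
    rw [tiltSum]
    ring

theorem sum_renyiDiv_of_not_dominated {P : X → ℝ} (hP : ∀ x, 0 ≤ P x) {W : X → Y → ℝ} {S : Y → ℝ}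
    {l : ℝ} (hl : 1 < l) (h : ¬ Dominated P W fun _ => S) :
    ∑ a, (P a : EReal) * renyiDiv l (W a) S = ⊤ := by
  classical
  simp only [Dominated, not_forall] at h
  obtain ⟨a, y, ha, hy, hW⟩ := h
  have hpos : 0 < P a := lt_of_le_of_ne (hP a) (Ne.symm ha)
  have htop : (P a : EReal) * renyiDiv l (W a) S = ⊤ := by
    rw [renyiDiv, if_neg hl.ne', if_neg fun hac : AbsCont (W a) S => hW (hac y hy),
      EReal.coe_mul_top_of_pos hpos]
  rw [← Finset.add_sum_erase _ _ (Finset.mem_univ a), htop]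
  refine EReal.top_add_of_ne_bot (ereal_sum_ne_bot _ fun b => ?_)
  rcases (hP b).eq_or_lt with hb | hb
  · simp [← hb]
  · rw [renyiDiv, if_neg hl.ne']
    split_ifs
    · rw [← EReal.coe_mul]
      exact EReal.coe_ne_bot _
    · rw [EReal.coe_mul_top_of_pos hb]
      exact top_ne_bot

theorem dualObjective_one (R : ℝ) (P : X → ℝ) (W : X → Y → ℝ) : dualObjective R P W 1 = 0 := by
  simp [dualObjective]

/-- A bound for every dominating S suffices, since any other S contributes ⊤ to the infimum defining
Csiszár's information. -/
theorem dualObjective_le {R : ℝ} {P : X → ℝ} (hP : ∀ x, 0 ≤ P x) {W : X → Y → ℝ} {l v : ℝ}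
    (hl : 1 < l)
    (h : ∀ S ∈ stdSimplex ℝ Y, Dominated P W (fun _ => S) →
      (l - 1) / l * R - 1 / l * ∑ x, P x * Real.log (tiltSum l W S x) ≤ v) :
    dualObjective R P W l ≤ v := by
  have hl1 : 0 < l - 1 := by linarith
  have hl0 : 0 < l := by linarith
  have hr : 0 < (l - 1) / l := by positivity
  have hc : ((R - v / ((l - 1) / l) : ℝ) : EReal) ≤ csiszarInfo l P W := by
    refine le_iInf₂ fun S hS => ?_
    by_cases hd : Dominated P W fun _ => S
    · rw [sum_renyiDiv_of_dominated hl hd, EReal.coe_le_coe_iff]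
      have h1 := h S hS hd
      set L := ∑ x, P x * Real.log (tiltSum l W S x)
      have h2 : (l - 1) / l * R - 1 / l * L = (l - 1) / l * (R - 1 / (l - 1) * L) := by
        field_simp
      rw [h2, mul_comm, ← le_div_iff₀ hr] at h1
      linarith
    · rw [sum_renyiDiv_of_not_dominated hP hl hd]
      exact le_top
  calc dualObjective R P W l
      ≤ (((l - 1) / l : ℝ) : EReal) * ((R : EReal) - ((R - v / ((l - 1) / l) : ℝ) : EReal)) :=
        mul_le_mul_of_nonneg_left (EReal.sub_le_sub le_rfl hc) (by exact_mod_cast hr.le)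
    _ = v := by
        rw [← EReal.coe_sub, ← EReal.coe_mul, EReal.coe_eq_coe_iff]
        field_simp
        ring

theorem le_dualObjective {R : ℝ} {P : X → ℝ} {W : X → Y → ℝ} {l : ℝ} (hl : 1 < l) {S : Y → ℝ}
    (hS : S ∈ stdSimplex ℝ Y) (hd : Dominated P W fun _ => S) :
    (((l - 1) / l * R - 1 / l * ∑ x, P x * Real.log (tiltSum l W S x) : ℝ) : EReal)
      ≤ dualObjective R P W l := by
  have hl1 : 0 < l - 1 := by linarith
  have hl0 : 0 < l := by linarith
  have hr : 0 < (l - 1) / l := by positivity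
  have hc : csiszarInfo l P W ≤
      ((1 / (l - 1) * ∑ x, P x * Real.log (tiltSum l W S x) : ℝ) : EReal) := by
    rw [← sum_renyiDiv_of_dominated hl hd]
    exact iInf₂_le S hS
  refine le_trans (le_of_eq ?_)
    (mul_le_mul_of_nonneg_left (EReal.sub_le_sub le_rfl hc) (by exact_mod_cast hr.le))
  rw [← EReal.coe_sub, ← EReal.coe_mul, EReal.coe_eq_coe_iff]
  field_simp

/-! ### Positivity of divergence and attainment of the dual. -/

/-- This is log z ≤ z - 1 at z = o/w, scaled by w. Its sum is Gibbs' inequality, and the strict form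
yields positive mutual information. -/
theorem sub_le_mul_log_div {w o : ℝ} (hw : 0 ≤ w) (ho : 0 ≤ o) (h : o = 0 → w = 0) :
    w - o ≤ w * Real.log (w / o) ∧ (w ≠ o → w - o < w * Real.log (w / o)) := by
  rcases hw.eq_or_lt with rfl | hw
  · refine ⟨by simpa using ho, fun hne => ?_⟩
    simpa using lt_of_le_of_ne ho hne
  have ho' : 0 < o := lt_of_le_of_ne ho fun h' => hw.ne' (h h'.symm)
  have e : w * Real.log (w / o) = -(w * Real.log (o / w)) := by
    rw [← inv_div, Real.log_inv]; ring
  have e2 : w * (o / w - 1) = o - w := by field_simp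
  rw [e]
  constructor
  · have := mul_le_mul_of_nonneg_left (Real.log_le_sub_one_of_pos (div_pos ho' hw)) hw.le
    linarith
  · intro hne
    have hne' : o / w ≠ 1 := fun h => hne ((div_eq_one_iff_eq hw.ne').1 h).symm
    have := mul_lt_mul_of_pos_left (Real.log_lt_sub_one_of_pos (div_pos ho' hw) hne') hw
    linarith

theorem sum_mul_sub_eq_zero (P : X → ℝ) {Q W : X → Y → ℝ} (hQ : IsChannel Q) (hW : IsChannel W) :
    ∑ x, ∑ y, P x * (Q x y - W x y) = 0 := by
  simp [← Finset.mul_sum, Finset.sum_sub_distrib, (hQ _).2, (hW _).2]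

omit [Fintype X] [Fintype Y] in
theorem mul_sub_le_mul_log {P : X → ℝ} (hP : ∀ x, 0 ≤ P x) {Q W : X → Y → ℝ}
    (hQ : ∀ x y, 0 ≤ Q x y) (hW : ∀ x y, 0 ≤ W x y) (h : Dominated P Q W) (x : X) (y : Y) :
    P x * (Q x y - W x y) ≤ P x * (Q x y * Real.log (Q x y / W x y)) := by
  by_cases hx : P x = 0
  · simp [hx]
  · exact mul_le_mul_of_nonneg_left (sub_le_mul_log_div (hQ x y) (hW x y) (h x y hx)).1 (hP x)

theorem condDiv_nonneg {P : X → ℝ} (hP : ∀ x, 0 ≤ P x) {Q W : X → Y → ℝ} (hQ : IsChannel Q)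
    (hW : IsChannel W) (h : Dominated P Q W) : 0 ≤ condDiv P Q W := by
  rw [← sum_mul_sub_eq_zero P hQ hW]
  exact Finset.sum_le_sum fun x _ => Finset.sum_le_sum fun y _ =>
    mul_sub_le_mul_log hP (fun x => (hQ x).1) (fun x => (hW x).1) h x y

theorem condDiv_self (P : X → ℝ) (W : X → Y → ℝ) : condDiv P W W = 0 := by
  refine Finset.sum_eq_zero fun x _ => Finset.sum_eq_zero fun y _ => ?_
  by_cases hy : W x y = 0
  · simp [hy]
  · simp [div_self hy]

/-- The mutual information of a non-degenerate channel is positive. -/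
theorem mutInf_pos {P : X → ℝ} (hP : P ∈ stdSimplex ℝ X) {W : X → Y → ℝ} (hW : IsChannel W)
    (hnd : ¬ IsDegenerate P W) : 0 < mutInf P W := by
  simp only [IsDegenerate, not_forall] at hnd
  obtain ⟨x, hx, hne⟩ := hnd
  obtain ⟨y, hy⟩ := Function.ne_iff.1 hne
  have hW0 : ∀ x y, 0 ≤ W x y := fun x => (hW x).1
  have ho := outputDist_nonneg hP.1 hW0
  have hd := dominated_outputDist hP.1 hW0
  have hO : IsChannel fun _ : X => outputDist P W := fun _ =>
    ⟨ho, sum_outputDist hP.2 fun x => (hW x).2⟩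
  have hle := fun x y => mul_sub_le_mul_log hP.1 hW0 (fun _ => ho) hd x y
  rw [← sum_mul_sub_eq_zero P hW hO]
  refine Finset.sum_lt_sum (fun x _ => Finset.sum_le_sum fun y _ => hle x y)
    ⟨x, Finset.mem_univ x, Finset.sum_lt_sum (fun y _ => hle x y) ⟨y, Finset.mem_univ y, ?_⟩⟩
  exact mul_lt_mul_of_pos_left
    ((sub_le_mul_log_div (hW0 x y) (ho y) (hd x y hx)).2 hy) (lt_of_le_of_ne (hP.1 x) (Ne.symm hx))

/-- Strong duality, with the dual optimum given by an order and an output distribution. -/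
theorem exists_dual_optimizer {R : ℝ} {P : X → ℝ} (hP : P ∈ stdSimplex ℝ X) {W : X → Y → ℝ}
    (hW : IsChannel W) :
    ∃ Q ∈ dominatedChannels P W,
      (∀ Q' ∈ dominatedChannels P W, condDiv P Q W + 1 / 2 * max 0 (R - mutInf P Q)
        ≤ condDiv P Q' W + 1 / 2 * max 0 (R - mutInf P Q')) ∧
      ∃ l ∈ Set.Icc (1 : ℝ) 2, ∃ S ∈ stdSimplex ℝ Y, Dominated P W (fun _ => S) ∧
        condDiv P Q W + 1 / 2 * max 0 (R - mutInf P Q)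
          ≤ (l - 1) / l * R - 1 / l * ∑ x, P x * Real.log (tiltSum l W S x) := by
  obtain ⟨Q, hQ, r, ⟨hr0, hr1⟩, h1, h2⟩ := exists_primal_minimizer R hP.1 hW
  refine ⟨Q, hQ, h1, ?_⟩
  rcases hr0.eq_or_lt with rfl | hr0
  -- Zero multiplier: testing at W shows the optimum is at most 0, the dual value at l = 1.
  · have h3 := h2 W (self_mem_dominatedChannels P hW)
    rw [lagrangian, condDiv_self, zero_mul, add_zero] at h3
    refine ⟨1, ⟨le_rfl, one_le_two⟩, outputDist P W,
      ⟨outputDist_nonneg hP.1 fun x => (hW x).1, sum_outputDist hP.2 fun x => (hW x).2⟩,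
      dominated_outputDist hP.1 fun x => (hW x).1, h3.trans (le_of_eq ?_)⟩
    have : ∀ x, tiltSum 1 W (outputDist P W) x = 1 := fun x => by
      simpa [tiltSum] using (hW x).2
    simp [this]
  -- Since 0 < r ≤ 1/2, r(R - I) ≤ ½[R - I]₊; together with `h2` this makes Q a minimizer of its own
  -- Lagrangian.
  · have hlag : lagrangian R P W r Q ≤ condDiv P Q W + 1 / 2 * max 0 (R - mutInf P Q) := by
      rw [lagrangian]
      have h3 := le_max_left 0 (R - mutInf P Q)
      have h4 := mul_le_mul_of_nonneg_left (le_max_right 0 (R - mutInf P Q)) hr0.le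
      have h5 := mul_le_mul_of_nonneg_right hr1 h3
      linarith
    have hr' : 0 < 1 - r := by linarith
    have h6 := lagrangian_le_of_isMin hP.1 hP.2 hW hr0 (by linarith) hQ
      fun Q' hQ' => hlag.trans (h2 Q' hQ')
    have hQ0 : ∀ x y, 0 ≤ Q x y := fun x => (hQ.1 x).1
    refine ⟨1 / (1 - r), ⟨?_, ?_⟩, outputDist P Q,
      ⟨outputDist_nonneg hP.1 hQ0, sum_outputDist hP.2 fun x => (hQ.1 x).2⟩,
      dominated_outputDist_of_isMin hP.1 hW hr0 (by linarith) hQ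
        fun Q' hQ' => hlag.trans (h2 Q' hQ'), (h2 Q hQ).trans (h6.trans (le_of_eq ?_))⟩
    · rw [le_div_iff₀ hr']; linarith
    · rw [div_le_iff₀ hr']; linarith
    · have e1 : (1 / (1 - r) - 1) / (1 / (1 - r)) = r := by field_simp; ring
      have e2 : 1 / (1 / (1 - r)) = 1 - r := by field_simp
      rw [e1, e2]

/-- A channel that does at least as well as `W` in the primal problem satisfies
`D(Q ‖ W | P) < I(P, Q)`. -/
theorem condDiv_lt_mutInf {R : ℝ} {P : X → ℝ} (hP : ∀ x, 0 ≤ P x) {W Q : X → Y → ℝ}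
    (hW : IsChannel W) (hI : 0 < mutInf P W) (hR : mutInf P W < R)
    (hQ : Q ∈ dominatedChannels P W)
    (h : condDiv P Q W + 1 / 2 * max 0 (R - mutInf P Q)
      ≤ condDiv P W W + 1 / 2 * max 0 (R - mutInf P W)) :
    condDiv P Q W < mutInf P Q := by
  have hD := condDiv_nonneg hP hQ.1 hW hQ.2
  rw [condDiv_self, max_eq_right (sub_pos.2 hR).le] at h
  -- If I(P,Q) ≤ R, the comparison gives 2D + I(P,W) ≤ I(P,Q). Otherwise 2D ≤ R - I(P,W), so D < R ≤
  -- I(P,Q).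
  rcases le_total (mutInf P Q) R with h1 | h1
  · rw [max_eq_right (sub_nonneg.2 h1)] at h
    linarith
  · rw [max_eq_left (sub_nonpos.2 h1)] at h
    linarith

end SoftCovering

/-! ### The exponent and its two formulas. -/

theorem theorem2 {X Y : Type*} [Fintype X] [Fintype Y] (m : ℕ) (hm : 0 < m)
    (P : X → ℝ) (hP : SoftCovering.IsType m P)
    (W : X → Y → ℝ) (hW : SoftCovering.IsChannel W)
    (hnd : ¬ SoftCovering.IsDegenerate P W)
    (R : ℝ) (hR : SoftCovering.mutualInfo P W < (R : EReal)) :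
    (∀ᶠ k : ℕ in atTop,
      0 < SoftCovering.expectedTV P W (m * k) ⌈Real.exp (((m * k : ℕ) : ℝ) * R)⌉₊) ∧
    ∃ aleph : ℝ,
      Tendsto
        (fun k : ℕ => -(1 / ((m * k : ℕ) : ℝ)) *
          Real.log (SoftCovering.expectedTV P W (m * k) ⌈Real.exp (((m * k : ℕ) : ℝ) * R)⌉₊))
        atTop (𝓝 aleph) ∧
      IsLeast (SoftCovering.primalObjective R P W '' {Q | SoftCovering.IsChannel Q})
        (aleph : EReal) ∧
      IsGreatest (SoftCovering.dualObjective R P W '' Set.Icc (1 : ℝ) 2) (aleph : EReal) := by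
  open SoftCovering in
  have hP0 := hP.1.1
  have hI := mutInf_pos hP.1 hW hnd
  rw [mutualInfo, mutualInfo_eq hP0 fun x => (hW x).1, EReal.coe_lt_coe_iff] at hR
  obtain ⟨Q, hQ, hmin, l, hl, S, hS, hWS, hdual⟩ := exists_dual_optimizer (R := R) hP.1 hW
  have hDI := condDiv_lt_mutInf hP0 hW hI hR hQ (hmin W (self_mem_dominatedChannels P hW))
  have hlow := fun ε hε => eventually_exp_le_expectedTV hm hP hW hQ hDI (hI.trans hR).le
    (ε := ε) hε
  have hD0 := condDiv_nonneg hP0 hQ.1 hW hQ.2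
  set v := condDiv P Q W + 1 / 2 * max 0 (R - mutInf P Q) with hv
  have hv0 : 0 ≤ v := by positivity
  have hpos : ∀ᶠ k : ℕ in atTop,
      0 < expectedTV P W (m * k) ⌈Real.exp (((m * k : ℕ) : ℝ) * R)⌉₊ :=
    (hlow 1 one_pos).mono fun k hk => (Real.exp_pos _).trans_le hk
  have hlog_low : ∀ ε, 0 < ε → ∀ᶠ k : ℕ in atTop, -(1 / ((m * k : ℕ) : ℝ)) *
      Real.log (expectedTV P W (m * k) ⌈Real.exp (((m * k : ℕ) : ℝ) * R)⌉₊) ≤ v + ε := by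
    intro ε hε
    filter_upwards [hlow ε hε, eventually_gt_atTop 0] with k hk hk0
    have hn : (0 : ℝ) < ((m * k : ℕ) : ℝ) := by positivity
    have h1 := (Real.le_log_iff_exp_le ((Real.exp_pos _).trans_le hk)).2 hk
    rw [neg_mul, neg_le, one_div, inv_mul_eq_div, le_div_iff₀ hn]
    linarith
  have hlog_up : ∀ l ∈ Set.Icc (1 : ℝ) 2, ∀ S ∈ stdSimplex ℝ Y, Dominated P W (fun _ => S) →
      ∀ ε, 0 < ε → ∀ᶠ k : ℕ in atTop,
        (l - 1) / l * R - 1 / l * ∑ x, P x * Real.log (tiltSum l W S x) - ε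
          ≤ -(1 / ((m * k : ℕ) : ℝ)) *
            Real.log (expectedTV P W (m * k) ⌈Real.exp (((m * k : ℕ) : ℝ) * R)⌉₊) := by
    intro l hl S hS hWS ε hε
    have hmk : Tendsto (fun k : ℕ => m * k) atTop atTop := tendsto_id.const_mul_atTop' hm
    have h3 := hmk.eventually
      ((tendsto_const_div_atTop_nhds_zero_nat (Real.log 3)).eventually (gt_mem_nhds hε))
    filter_upwards [hpos, h3, eventually_gt_atTop 0] with k hk hk3 hk0
    have hn : (0 : ℝ) < ((m * k : ℕ) : ℝ) := by positivity
    have h1 := Real.log_le_log hk (expectedTV_le_exp hW hS hWS hl (R := R)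
      (by positivity : 0 < m * k) (typeClass_nonempty hm hk0 hP) (Nat.le_ceil _))
    rw [Real.log_mul (by norm_num) (Real.exp_pos _).ne', Real.log_exp] at h1
    rw [div_lt_iff₀ hn] at hk3
    rw [neg_mul, le_neg, one_div, inv_mul_eq_div, div_le_iff₀ hn]
    linarith
  -- Weak duality read off operationally: at one large block length, a dual value minus ε/2 lies
  -- below the normalized logarithm, which lies below v + ε/2.
  have hweak : ∀ l ∈ Set.Icc (1 : ℝ) 2, ∀ S ∈ stdSimplex ℝ Y, Dominated P W (fun _ => S) →
      (l - 1) / l * R - 1 / l * ∑ x, P x * Real.log (tiltSum l W S x) ≤ v := by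
    intro l hl S hS hWS
    refine le_of_forall_pos_le_add fun ε hε => ?_
    obtain ⟨k, h1, h2⟩ := ((hlog_low (ε / 2) (half_pos hε)).and
      (hlog_up l hl S hS hWS (ε / 2) (half_pos hε))).exists
    linarith
  have hdual_le : ∀ l ∈ Set.Icc (1 : ℝ) 2, dualObjective R P W l ≤ (v : EReal) := by
    intro l hl
    -- At l = 1 the prefactor (l - 1)/l is zero, so the value is 0 whatever the information term.
    rcases hl.1.eq_or_lt with rfl | h1
    · rw [dualObjective_one]
      exact_mod_cast hv0
    · exact dualObjective_le hP0 h1 fun S hS hWS => hweak l hl S hS hWS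
  refine ⟨hpos, v, ?_, ⟨⟨Q, hQ.1, primalObjective_of_dominated hP0 hQ⟩, ?_⟩, ⟨⟨l, hl, ?_⟩, ?_⟩⟩
  · rw [tendsto_order]
    refine ⟨fun a ha => ?_, fun a ha => ?_⟩
    · filter_upwards [hlog_up l hl S hS hWS ((v - a) / 2) (by linarith)] with k hk
      linarith
    · filter_upwards [hlog_low ((a - v) / 2) (by linarith)] with k hk
      linarith
  · rintro _ ⟨Q', hQ', rfl⟩
    by_cases hd : Dominated P Q' W
    · rw [primalObjective_of_dominated hP0 ⟨hQ', hd⟩, EReal.coe_le_coe_iff]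
      exact hmin Q' ⟨hQ', hd⟩
    · rw [primalObjective_of_not_dominated hd]
      exact le_top
  · refine le_antisymm (hdual_le l hl) ?_
    rcases hl.1.eq_or_lt with rfl | h1
    · have hone : ∀ x, tiltSum 1 W S x = 1 := fun x => by simpa [tiltSum] using (hW x).2
      simp only [hone, Real.log_one, mul_zero, Finset.sum_const_zero, sub_self, zero_div,
        zero_mul] at hdual
      rw [dualObjective_one]
      exact_mod_cast hdual
    · exact le_trans (EReal.coe_le_coe_iff.2 hdual) (le_dualObjective h1 hS hWS)
  · rintro _ ⟨l', hl', rfl⟩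
    exact hdual_le l' hl'
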